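/- Let $p\in(0,1)$ be a constant, and let $G(n,p)$ be the binomial random graph on $n$ labelled vertices, in which each pair of vertices is joined by an edge independently with probability $p$. Then there exists an $\varepsilon>0$ (which may depend on $p$) such that, with probability tending to $1$ as $n\to\infty$, the maximum number of vertices of an induced subgraph of $G(n,p)$ that is a tree belongs to $\{f_{\varepsilon}(n),\,f_{\varepsilon}(n)+1\}$, where $$f_{\varepsilon}(n)=\left\lfloor 2\log_{1/(1-p)}(enp)+2+\varepsilon\right\rfloor .$$ -/

import Mathlib

open Filter Topology ProbabilityTheory

/-- The set of all numbers of vertices of induced subgraphs of `G` that are trees. -/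
def inducedTreeSizes {V : Type*} (G : SimpleGraph V) : Set ℕ :=
  {k | ∃ S : Finset V, S.card = k ∧ (G.induce (S : Set V)).IsTree}

/-- The maximum number of vertices of an induced tree in `G`. On a finite non-empty vertex set
this is an attained maximum, see `isGreatest_maxInducedTree`. -/
noncomputable def maxInducedTree {V : Type*} (G : SimpleGraph V) : ℕ :=
  sSup (inducedTreeSizes G)

theorem isGreatest_maxInducedTree {V : Type*} [Fintype V] [Nonempty V] (G : SimpleGraph V) :
    IsGreatest (inducedTreeSizes G) (maxInducedTree G) := by
  have hb : BddAbove (inducedTreeSizes G) := by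
    refine ⟨Fintype.card V, ?_⟩
    rintro k ⟨S, rfl, -⟩
    exact S.card_le_univ
  have hne : (inducedTreeSizes G).Nonempty := by
    obtain ⟨v⟩ := ‹Nonempty V›
    refine ⟨1, {v}, Finset.card_singleton v, ?_⟩
    rw [Finset.coe_singleton]
    exact SimpleGraph.IsTree.of_subsingleton
  exact ⟨Nat.sSup_mem hne hb, fun k hk => le_csSup hb hk⟩

/-- `f_ε(n) = ⌊2 log_{1/(1-p)} (e n p) + 2 + ε⌋`. -/
noncomputable def treeThreshold (p ε : ℝ) (n : ℕ) : ℤ :=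
  ⌊2 * Real.logb (1 / (1 - p)) (Real.exp 1 * n * p) + 2 + ε⌋

/-! Write q = 1 - p, z = enp and L = log_{1/q} z. The expected number of induced trees on k vertices
is C(n,k) k^{k-2} p^{k-1} q^{C(k-1,2)}, which up to factors polynomial in k is (z q^{(k-3)/2})^k. It
therefore crosses 1 near k = 2L + 3. For ε = 1/2 and k = f_ε(n), the floor puts k - 2L in (3/2,
5/2]. So the expectation is exponentially large in k at size k and exponentially small at size k +
2. Trees lose leaves, so excluding k + 2 excludes all larger sizes (`mem_inducedTreeSizes_of_le`),
and the maximum is k or k + 1 once size k is attained.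

Attainment comes from the second moment (`secondMoment_bound`), applied only to trees of bounded
degree. The restriction costs an exponential factor (1 - 1/D)^{k-1}, which a large D brings within
the slack (`card_boundedTrees_ge`). The count is a double counting of rooted forests, in the style
of Pitman's proof of Cayley's formula (`card_parentMaps_step`).

Pairs of k-sets are sorted by their overlap l. For l ≤ 1 no pair of vertices is shared and the
covariance is not positive. For 2 ≤ l ≤ k/2 a shared l-set has probability about (k²/n)^l, which
beats the gain q^{-C(l,2)} (`smallOverlap_le`). For l > k/2 the bounded degree is essential: given
the first tree, the second is free in only d(k - l) edges, so it has at most k^{2d(k-l)} choices,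
and these lose against the new pairs that must be non-edges (`largeOverlap_le`). -/

/-! ### Cylinder probabilities and the second moment method -/

instance discreteMeasurableSpace_simpleGraph {V : Type*} [Finite V] :
    DiscreteMeasurableSpace (SimpleGraph V) := by
  have : MeasurableSingletonClass (SimpleGraph V) := by
    refine ⟨fun G => ?_⟩
    have : ({G} : Set (SimpleGraph V)) = SimpleGraph.edgeSet ⁻¹' {G.edgeSet} := by
      ext H; simp
    rw [this]
    exact SimpleGraph.measurable_edgeSet (measurableSet_singleton _)
  infer_instance

open MeasureTheory Measure unitInterval in
/-- The probability that `G(n, p)` has a prescribed trace on a finite set of pairs. -/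
theorem binomialRandom_real_trace {V : Type*} [Fintype V] [DecidableEq V] (p : I)
    {F A : Finset (Sym2 V)} (hF : ∀ e ∈ F, ¬ e.IsDiag) (hA : A ⊆ F) :
    (SimpleGraph.binomialRandom V p).real {G | ∀ e ∈ F, e ∈ G.edgeSet ↔ e ∈ A} =
      (p : ℝ) ^ A.card * (1 - p : ℝ) ^ (F.card - A.card) := by
  rw [measureReal_def, SimpleGraph.binomialRandom_eq_map,
    Measure.map_apply SimpleGraph.measurable_fromEdgeSet .of_discrete, setBernoulli_apply']
  -- No pair in `F` is diagonal, so `fromEdgeSet` discards nothing there and the event is a box in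
  -- the product space.
  have hset : (fun q : Sym2 V → Prop => {i | q i}) ⁻¹' (SimpleGraph.fromEdgeSet ⁻¹'
      {G : SimpleGraph V | ∀ e ∈ F, e ∈ G.edgeSet ↔ e ∈ A}) =
      Set.pi (F : Set (Sym2 V)) (fun e => {(e ∈ A)}) := by
    ext q
    simp only [Set.mem_preimage, Set.mem_ofPred_eq, SimpleGraph.edgeSet_fromEdgeSet, Set.mem_pi,
      Finset.mem_coe, Set.mem_singleton_iff, eq_iff_iff]
    refine forall₂_congr fun e he => ?_
    have := hF e he
    simp [this]
  rw [hset, infinitePi_pi _ (by intros; exact .of_discrete)]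
  have hterm : ∀ e ∈ F, ((toNNReal p • dirac (e ∈ (Sym2.diagSetᶜ : Set (Sym2 V))) +
      toNNReal (σ p) • dirac False : Measure Prop) {(e ∈ A)}) =
      if e ∈ A then (toNNReal p : ENNReal) else (toNNReal (σ p) : ENNReal) := by
    intro e he
    have := hF e he
    by_cases h : e ∈ A <;> simp [h, this, Set.indicator]
  rw [Finset.prod_congr rfl hterm, Finset.prod_ite, Finset.prod_const, Finset.prod_const,
    Finset.filter_mem_eq_inter, Finset.inter_eq_right.2 hA, Finset.filter_notMem_eq_sdiff,
    Finset.card_sdiff_of_subset hA]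
  simp

open MeasureTheory in
/-- The second moment method for a finite family of events. -/
theorem secondMoment_bound {Ω ι : Type*} [MeasurableSpace Ω] (μ : Measure Ω)
    [IsProbabilityMeasure μ] (s : Finset ι) (A : ι → Set Ω) (hA : ∀ i ∈ s, MeasurableSet (A i)) :
    (∑ i ∈ s, μ.real (A i)) ^ 2 * μ.real {ω | ∀ i ∈ s, ω ∉ A i} ≤
      ∑ i ∈ s, ∑ j ∈ s, (μ.real (A i ∩ A j) - μ.real (A i) * μ.real (A j)) := by
  set m := ∑ i ∈ s, μ.real (A i) with hm
  set N : Set Ω := {ω | ∀ i ∈ s, ω ∉ A i} with hN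
  have hNm : MeasurableSet N := by
    have : N = ⋂ i ∈ s, (A i)ᶜ := by ext; simp [hN]
    rw [this]
    exact Finset.measurableSet_biInter s fun i hi => (hA i hi).compl
  set X : Ω → ℝ := fun ω => ∑ i ∈ s, (A i).indicator 1 ω with hX
  have hint1 : ∀ i ∈ s, Integrable ((A i).indicator (1 : Ω → ℝ)) μ := fun i hi =>
    (integrable_const (1 : ℝ)).indicator (hA i hi)
  have hint2 : ∀ i ∈ s, ∀ j ∈ s, Integrable ((A i ∩ A j).indicator (1 : Ω → ℝ)) μ :=
    fun i hi j hj => (integrable_const (1 : ℝ)).indicator ((hA i hi).inter (hA j hj))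
  have hXint : Integrable X μ := integrable_finsetSum s hint1
  have hXX : ∀ ω, X ω ^ 2 = ∑ i ∈ s, ∑ j ∈ s, (A i ∩ A j).indicator (1 : Ω → ℝ) ω := by
    intro ω
    simp only [hX, sq, Finset.sum_mul_sum, Set.inter_indicator_one, Pi.mul_apply]
  have hXXint : Integrable (fun ω => X ω ^ 2) μ := by
    simp only [hXX]
    exact integrable_finsetSum s fun i hi => integrable_finsetSum s fun j hj => hint2 i hi j hj
  have hEX : ∫ ω, X ω ∂μ = m := by
    rw [hX, integral_finsetSum s hint1, hm]
    exact Finset.sum_congr rfl fun i hi => by rw [integral_indicator_one (hA i hi)]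
  have hEXX : ∫ ω, X ω ^ 2 ∂μ = ∑ i ∈ s, ∑ j ∈ s, μ.real (A i ∩ A j) := by
    simp only [hXX]
    rw [integral_finsetSum s fun i hi => integrable_finsetSum s fun j hj => hint2 i hi j hj]
    refine Finset.sum_congr rfl fun i hi => ?_
    rw [integral_finsetSum s fun j hj => hint2 i hi j hj]
    exact Finset.sum_congr rfl fun j hj => by
      rw [integral_indicator_one ((hA i hi).inter (hA j hj))]
  -- Chebyshev's argument pointwise: (X - m)² is nonnegative, and equals m² on `N`, where X = 0.
  have hle : ∫ ω, N.indicator (fun _ => m ^ 2) ω ∂μ ≤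
      ∫ ω, (X ω ^ 2 - 2 * m * X ω + m ^ 2) ∂μ := by
    refine integral_mono ((integrable_const _).indicator hNm)
      ((hXXint.sub (hXint.const_mul _)).add (integrable_const _)) fun ω => ?_
    by_cases h : ω ∈ N
    · have h0 : X ω = 0 := Finset.sum_eq_zero fun i hi => by simp [h i hi]
      simp [h, h0]
    · simp only [h, not_false_eq_true, Set.indicator_of_notMem]
      nlinarith [sq_nonneg (X ω - m)]
  have hsub : Integrable (fun ω => X ω ^ 2 - 2 * m * X ω) μ := hXXint.sub (hXint.const_mul _)
  rw [integral_indicator_const _ hNm, integral_add hsub (integrable_const _),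
    integral_sub hXXint (hXint.const_mul _), integral_const_mul, hEX, hEXX,
    integral_const, probReal_univ] at hle
  have hmm : ∑ i ∈ s, ∑ j ∈ s, μ.real (A i) * μ.real (A j) = m ^ 2 := by
    rw [hm, sq, Finset.sum_mul_sum]
  simp only [Finset.sum_sub_distrib, hmm]
  simp only [smul_eq_mul] at hle
  nlinarith

/-! ### Counting rooted forests of bounded branching -/

/-- A self-map is a forest of parent pointers if every point eventually reaches a fixed point. -/
def IsParentMap {V : Type*} (f : V → V) : Prop :=
  ∀ v, ∃ i : ℕ, f (f^[i] v) = f^[i] v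

open Classical in
/-- The forests of parent pointers with `m` roots in which every vertex has at most `D`
children. -/
noncomputable def parentMaps (V : Type*) [Fintype V] (D m : ℕ) : Finset (V → V) :=
  {f | IsParentMap f ∧ (Finset.univ.filter fun v => f v = v).card = m ∧
    ∀ v, (Finset.univ.filter fun u => f u = v ∧ u ≠ v).card ≤ D}

theorem mem_parentMaps {V : Type*} [Fintype V] [DecidableEq V] {D m : ℕ} {f : V → V} :
    f ∈ parentMaps V D m ↔ IsParentMap f ∧ (Finset.univ.filter fun v => f v = v).card = m ∧
    ∀ v, (Finset.univ.filter fun u => f u = v ∧ u ≠ v).card ≤ D := by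
  classical
  simp only [parentMaps, Finset.mem_filter, Finset.mem_univ, true_and]
  refine and_congr Iff.rfl (and_congr ?_ (forall_congr' fun v => ?_)) <;>
  · constructor <;> intro h <;> convert h

/-- Hanging a root below a vertex of another tree yields a forest again. -/
theorem IsParentMap.update {V : Type*} [DecidableEq V] {f : V → V} (hf : IsParentMap f) {v r : V}
    (hv : ∀ i : ℕ, f^[i] v ≠ r) : IsParentMap (Function.update f r v) := by
  set g := Function.update f r v with hg
  have hgr : g r = v := by simp [hg]
  have hgo : ∀ u, u ≠ r → g u = f u := fun u hu => by simp [hg, hu]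
  have hstep : ∀ u, (∃ i : ℕ, g (g^[i] (g u)) = g^[i] (g u)) → ∃ i : ℕ, g (g^[i] u) = g^[i] u := by
    rintro u ⟨i, hi⟩
    exact ⟨i + 1, by simpa [Function.iterate_succ_apply] using hi⟩
  -- The orbit of `v` avoids `r`, the only point where the map has changed.
  have hit : ∀ i : ℕ, g^[i] v = f^[i] v := by
    intro i
    induction i with
    | zero => rfl
    | succ i ih => rw [Function.iterate_succ_apply', Function.iterate_succ_apply', ih, hgo _ (hv i)]
  have hPv : ∃ i : ℕ, g (g^[i] v) = g^[i] v := by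
    obtain ⟨i, hi⟩ := hf v
    exact ⟨i, by rw [hit, hgo _ (hv i), hi]⟩
  have hPr : ∃ i : ℕ, g (g^[i] r) = g^[i] r := hstep r (by rwa [hgr])
  intro u
  obtain ⟨i, hi⟩ := hf u
  induction i generalizing u with
  | zero =>
    by_cases hu : u = r
    · rwa [hu]
    · exact ⟨0, by simpa [hgo u hu] using hi⟩
  | succ i ih =>
    by_cases hu : u = r
    · rwa [hu]
    · refine hstep u ?_
      rw [hgo u hu]
      exact ih (f u) (by simpa [Function.iterate_succ_apply] using hi)

/-- A point reaches at most one fixed point. -/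
theorem iterate_fixed_unique {V : Type*} {f : V → V} {v a b : V} (ha : f a = a) (hb : f b = b)
    {i j : ℕ} (hi : f^[i] v = a) (hj : f^[j] v = b) : a = b := by
  have h1 : f^[i + j] v = b := by
    rw [Function.iterate_add_apply, hj, Function.iterate_fixed hb]
  have h2 : f^[i + j] v = a := by
    rw [add_comm, Function.iterate_add_apply, hi, Function.iterate_fixed ha]
  rw [← h1, h2]

theorem update_mem_parentMaps {V : Type*} [Fintype V] [DecidableEq V] {D m : ℕ} {f : V → V}
    (hf : f ∈ parentMaps V D (m + 1)) {v r : V} (hr : f r = r) (hv : ∀ i : ℕ, f^[i] v ≠ r)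
    (hD : (Finset.univ.filter fun u => f u = v ∧ u ≠ v).card < D) :
    Function.update f r v ∈ parentMaps V D m := by
  obtain ⟨h1, h2, h3⟩ := mem_parentMaps.1 hf
  have hvr : v ≠ r := hv 0
  refine mem_parentMaps.2 ⟨h1.update hv, ?_, fun w => ?_⟩
  · have : (Finset.univ.filter fun u => Function.update f r v u = u) =
        (Finset.univ.filter fun u => f u = u).erase r := by
      ext u
      by_cases hu : u = r
      · subst hu; simp [hvr]
      · simp [hu]
    rw [this, Finset.card_erase_of_mem (by simp [hr]), h2]
    rfl
  · by_cases hw : w = v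
    · subst hw
      refine le_trans (Finset.card_le_card (t := insert r
        (Finset.univ.filter fun u => f u = w ∧ u ≠ w)) ?_) ?_
      · intro u
        by_cases hu : u = r
        · subst hu; simp
        · simp [hu]
      · exact (Finset.card_insert_le _ _).trans hD
    · refine le_trans (Finset.card_le_card ?_) (h3 w)
      intro u
      by_cases hu : u = r
      · subst hu; simp [Ne.symm hw]
      · simp [hu]

/-- Double counting of pairs of forests that differ by one parent pointer. -/
theorem card_parentMaps_step (V : Type*) [Fintype V] (D m : ℕ) :
    (parentMaps V D (m + 2)).card * ((D - 1) * Fintype.card V * (m + 1)) ≤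
      D * ((parentMaps V D (m + 1)).card * (Fintype.card V - (m + 1))) := by
  classical
  set k := Fintype.card V
  set good : (V → V) → Finset (V × V) := fun f => Finset.univ.filter fun x =>
    (Finset.univ.filter fun u => f u = x.1 ∧ u ≠ x.1).card < D ∧ f x.2 = x.2 ∧
      ∀ i : ℕ, f^[i] x.1 ≠ x.2 with hgood
  have hlow : ∀ f ∈ parentMaps V D (m + 2), (D - 1) * k * (m + 1) ≤ D * (good f).card := by
    intro f hf
    obtain ⟨h1, h2, h3⟩ := mem_parentMaps.1 hf
    set W := Finset.univ.filter fun v : V =>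
      (Finset.univ.filter fun u => f u = v ∧ u ≠ v).card < D with hW
    -- There are at most k children in total, so at most k/D vertices already have D of them.
    have hWc : (D - 1) * k ≤ D * W.card := by
      have hsum : ∑ v : V, (Finset.univ.filter fun u => f u = v ∧ u ≠ v).card ≤ k := by
        calc _ ≤ ∑ v : V, (Finset.univ.filter fun u => f u = v).card :=
              Finset.sum_le_sum fun v _ => Finset.card_le_card fun u => by simp +contextual
          _ = k := by
            rw [← Finset.card_eq_sum_card_fiberwise (s := Finset.univ) (t := Finset.univ)
              (f := f) (by simp)]
            rfl
      have hbig : (Finset.univ.filter fun v : V => v ∉ W).card * D ≤ k := by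
        refine le_trans ?_ hsum
        rw [← smul_eq_mul, ← Finset.sum_const]
        refine le_trans (Finset.sum_le_sum fun v hv => ?_)
          (Finset.sum_le_sum_of_subset (Finset.subset_univ _))
        simpa [hW] using hv
      have hcompl : W.card + (Finset.univ.filter fun v : V => v ∉ W).card = k := by
        have := Finset.card_filter_add_card_filter_not (s := (Finset.univ : Finset V))
          (fun v => v ∈ W)
        simpa using this
      rcases D with _ | D
      · simp
      · simp only [Nat.add_sub_cancel]
        nlinarith
    -- Every root except that of the tree containing `v` may be hung below `v`.
    have hprod : W.card * (m + 1) ≤ (good f).card := by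
      have : (good f).card = ∑ v ∈ W, ((Finset.univ.filter fun r => f r = r ∧
          ∀ i : ℕ, f^[i] v ≠ r)).card := by
        rw [← Finset.card_sigma]
        refine Finset.card_bij (fun x _ => ⟨x.1, x.2⟩) ?_ ?_ ?_
        · rintro ⟨v, r⟩ h
          simpa [hgood, hW] using h
        · rintro ⟨v, r⟩ _ ⟨v', r'⟩ _ h
          simp only [Sigma.mk.injEq, heq_eq_eq] at h
          exact Prod.ext h.1 h.2
        · rintro ⟨v, r⟩ h
          exact ⟨(v, r), by simpa [hgood, hW] using h, rfl⟩
      rw [this, ← smul_eq_mul, ← Finset.sum_const]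
      refine Finset.sum_le_sum fun v _ => ?_
      obtain ⟨i, hi⟩ := h1 v
      have hsub : (Finset.univ.filter fun r => f r = r).erase (f^[i] v) ⊆
          Finset.univ.filter fun r => f r = r ∧ ∀ i : ℕ, f^[i] v ≠ r := by
        intro r hr
        simp only [Finset.mem_erase, Finset.mem_filter, Finset.mem_univ, true_and] at hr ⊢
        exact ⟨hr.2, fun j hj => hr.1 (iterate_fixed_unique hr.2 hi hj rfl)⟩
      refine le_trans ?_ (Finset.card_le_card hsub)
      rw [Finset.card_erase_of_mem (by simp [hi]), h2]
      rfl
    calc (D - 1) * k * (m + 1) ≤ D * W.card * (m + 1) := Nat.mul_le_mul_right _ hWc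
      _ = D * (W.card * (m + 1)) := by ring
      _ ≤ _ := Nat.mul_le_mul_left _ hprod
  -- The move is undone by knowing `r`: its new parent is `v`, and before the move `r` was its own
  -- parent.
  have hinj : ((parentMaps V D (m + 2)).sigma good).card ≤
      ((parentMaps V D (m + 1)).sigma
        fun g => Finset.univ.filter fun r : V => g r ≠ r).card := by
    refine Finset.card_le_card_of_injOn
      (fun x => ⟨Function.update x.1 x.2.2 x.2.1, x.2.2⟩) ?_ ?_
    · rintro ⟨f, v, r⟩ h
      simp only [hgood, Finset.coe_sigma, Set.mem_sigma_iff, Finset.mem_coe, Finset.mem_filter,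
        Finset.mem_univ, true_and] at h ⊢
      obtain ⟨hf, hD, hr, hv⟩ := h
      refine ⟨update_mem_parentMaps hf hr hv hD, ?_⟩
      simpa using hv 0
    · rintro ⟨f, v, r⟩ h ⟨f', v', r'⟩ h' heq
      simp only [hgood, Finset.coe_sigma, Set.mem_sigma_iff, Finset.mem_coe, Finset.mem_filter,
        Finset.mem_univ, true_and] at h h'
      simp only [Sigma.mk.injEq, heq_eq_eq] at heq
      obtain ⟨he, rfl⟩ := heq
      have hvv : v = v' := by simpa using congrFun he r
      have hff : f = f' := by
        funext u
        by_cases hu : u = r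
        · rw [hu, h.2.2.1, h'.2.2.1]
        · simpa [hu] using congrFun he u
      rw [hvv, hff]
  rw [Finset.card_sigma, Finset.card_sigma] at hinj
  have hright : ∑ g ∈ parentMaps V D (m + 1), (Finset.univ.filter fun r : V => g r ≠ r).card =
      (parentMaps V D (m + 1)).card * (k - (m + 1)) := by
    rw [← smul_eq_mul, ← Finset.sum_const]
    refine Finset.sum_congr rfl fun g hg => ?_
    have := Finset.card_filter_add_card_filter_not (s := (Finset.univ : Finset V))
      (fun r => g r = r)
    rw [(mem_parentMaps.1 hg).2.1, Finset.card_univ] at this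
    exact Nat.eq_sub_of_add_eq' this
  calc _ = ∑ f ∈ parentMaps V D (m + 2), (D - 1) * k * (m + 1) := by
        rw [Finset.sum_const, smul_eq_mul]
    _ ≤ ∑ f ∈ parentMaps V D (m + 2), D * (good f).card := Finset.sum_le_sum hlow
    _ = D * ∑ f ∈ parentMaps V D (m + 2), (good f).card := by rw [Finset.mul_sum]
    _ ≤ _ := Nat.mul_le_mul_left _ (hinj.trans hright.le)

/-- A lower bound for the number of rooted trees with bounded branching. -/
theorem card_parentMaps_ge (V : Type*) [Fintype V] {D : ℕ} (hD : 0 < D) (i : ℕ)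
    (hi : i + 1 ≤ Fintype.card V) :
    ((1 - 1 / D : ℝ) * Fintype.card V) ^ i * (Fintype.card V - 1).choose i ≤
      (parentMaps V D (Fintype.card V - i)).card := by
  classical
  set k := Fintype.card V with hk
  induction i with
  | zero =>
    -- With k roots every vertex is a root, so the identity starts the induction.
    have : (id : V → V) ∈ parentMaps V D k := by
      refine mem_parentMaps.2 ⟨fun v => ⟨0, rfl⟩, by simp [hk], fun v => ?_⟩
      rw [Finset.card_eq_zero.2] <;> simp
    simpa using Finset.card_pos.2 ⟨_, this⟩
  | succ i ih =>
    have ih := ih (by omega)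
    have hstep := card_parentMaps_step V D (k - (i + 2))
    obtain ⟨c, hc⟩ : ∃ c, k = c + (i + 2) := ⟨k - (i + 2), by omega⟩
    rw [← hk, hc] at hstep
    rw [hc] at ih ⊢
    have e1 : c + (i + 2) - (i + 2) = c := by omega
    have e2 : c + (i + 2) - i = c + 2 := by omega
    have e3 : c + (i + 2) - (i + 1) = c + 1 := by omega
    have e4 : c + (i + 2) - (c + 1) = i + 1 := by omega
    have e5 : c + (i + 2) - 1 = c + i + 1 := by omega
    rw [e1, e4] at hstep
    rw [e2, e5] at ih
    rw [e3, e5]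
    have hch : ((c + i + 1).choose (i + 1) : ℝ) * (i + 1) = (c + i + 1).choose i * (c + 1) := by
      have := Nat.choose_succ_right_eq (c + i + 1) i
      rw [show c + i + 1 - i = c + 1 by omega] at this
      exact_mod_cast this
    have hstepR : ((parentMaps V D (c + 2)).card : ℝ) * ((D - 1) * (c + (i + 2) : ℕ) * (c + 1)) ≤
        D * ((parentMaps V D (c + 1)).card * (i + 1)) := by
      have : ((D - 1 : ℕ) : ℝ) = D - 1 := by rw [Nat.cast_sub hD]; simp
      rw [← this]
      exact_mod_cast hstep
    have hDR : (0 : ℝ) < D := by exact_mod_cast hD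
    have hD1 : (1 : ℝ) ≤ D := by exact_mod_cast hD
    set K : ℝ := ((c + (i + 2) : ℕ) : ℝ)
    have hK : 0 ≤ K := Nat.cast_nonneg _
    have h1D : (1 - 1 / D : ℝ) * D = D - 1 := by field_simp
    have h1D0 : (0 : ℝ) ≤ 1 - 1 / D := by
      rw [sub_nonneg, div_le_one hDR]; exact hD1
    refine le_of_mul_le_mul_right ?_ (show (0 : ℝ) < D * (i + 1) by positivity)
    calc ((1 - 1 / D) * K) ^ (i + 1) * ((c + i + 1).choose (i + 1) : ℝ) * (D * (i + 1))
        = ((1 - 1 / D) * K) ^ i * (((c + i + 1).choose (i + 1) : ℝ) * (i + 1)) *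
            (((1 - 1 / D) * D) * K) := by ring
      _ = (((1 - 1 / D) * K) ^ i * ((c + i + 1).choose i : ℝ)) * ((D - 1) * K * (c + 1)) := by
          rw [hch, h1D]; ring
      _ ≤ (parentMaps V D (c + 2)).card * ((D - 1) * K * (c + 1)) := by
          refine mul_le_mul_of_nonneg_right ih ?_
          have : (0 : ℝ) ≤ D - 1 := by linarith
          positivity
      _ ≤ _ := hstepR
      _ = _ := by ring

/-! ### From parent maps to trees -/

/-- The graph joining every vertex to its parent. -/
def parentGraph {V : Type*} (f : V → V) : SimpleGraph V :=
  SimpleGraph.fromRel fun u v => f u = v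

theorem parentGraph_adj {V : Type*} {f : V → V} {u v : V} :
    (parentGraph f).Adj u v ↔ u ≠ v ∧ (f u = v ∨ f v = u) :=
  SimpleGraph.fromRel_adj _ _ _

theorem parentGraph_reachable_iterate {V : Type*} (f : V → V) (v : V) (i : ℕ) :
    (parentGraph f).Reachable v (f^[i] v) := by
  induction i with
  | zero => exact SimpleGraph.Reachable.refl _
  | succ i ih =>
    rw [Function.iterate_succ_apply']
    refine ih.trans ?_
    by_cases h : f^[i] v = f (f^[i] v)
    · rw [← h]
    · exact SimpleGraph.Adj.reachable (parentGraph_adj.2 ⟨h, Or.inl rfl⟩)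

theorem parentGraph_connected {V : Type*} {f : V → V} {r : V} (h : ∀ v, ∃ i : ℕ, f^[i] v = r) :
    (parentGraph f).Connected := by
  have hr : ∀ v, (parentGraph f).Reachable v r := fun v => by
    obtain ⟨i, hi⟩ := h v
    exact hi ▸ parentGraph_reachable_iterate f v i
  exact { preconnected := fun u v => (hr u).trans (hr v).symm, nonempty := ⟨r⟩ }

/-- Each edge joins a non-root to its parent, so there are at most |V| - 1 edges, the least a
connected graph can have. -/
theorem parentGraph_isTree {V : Type*} [Fintype V] {f : V → V} {r : V} (hr : f r = r)
    (h : ∀ v, ∃ i : ℕ, f^[i] v = r) : (parentGraph f).IsTree := by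
  classical
  have hc := parentGraph_connected h
  refine SimpleGraph.isTree_iff_connected_and_card.2
    ⟨hc, le_antisymm ?_ hc.card_vert_le_card_edgeSet_add_one⟩
  have hsub : (parentGraph f).edgeSet ⊆
      ((Finset.univ.erase r).image fun v => s(v, f v) : Finset (Sym2 V)) := by
    intro e
    induction e using Sym2.ind with
    | _ u v =>
      intro he
      obtain ⟨hne, h | h⟩ := parentGraph_adj.1 he
      · simp only [Finset.coe_image, Set.mem_image, Finset.mem_coe, Finset.mem_erase,
          Finset.mem_univ, and_true]
        exact ⟨u, fun hu => hne (by rw [← h, hu, hr]), by rw [h]⟩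
      · simp only [Finset.coe_image, Set.mem_image, Finset.mem_coe, Finset.mem_erase,
          Finset.mem_univ, and_true]
        exact ⟨v, fun hv => hne (by rw [← h, hv, hr]), by rw [h, Sym2.eq_swap]⟩
  have h1 : (parentGraph f).edgeSet.ncard ≤ Fintype.card V - 1 := by
    refine (Set.ncard_le_ncard hsub (Finset.finite_toSet _)).trans ?_
    rw [Set.ncard_coe_finset]
    exact Finset.card_image_le.trans (by simp)
  have h2 : 0 < Fintype.card V := Fintype.card_pos_iff.2 ⟨r⟩
  rw [Nat.card_eq_fintype_card (α := V), Nat.card_coe_set_eq]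
  omega

/-- A parent map is determined by its root and its graph. -/
theorem parentGraph_injective {V : Type*} {f g : V → V} {r : V} (hf : f r = r) (hg : g r = r)
    (hfr : ∀ v, ∃ i : ℕ, f^[i] v = r) (hfg : parentGraph f = parentGraph g) : f = g := by
  have hno : ∀ v, v ≠ r → f v ≠ v := fun v hv h => by
    obtain ⟨i, hi⟩ := hfr v
    rw [Function.iterate_fixed h] at hi
    exact hv hi
  -- On a 2-cycle the orbit alternates between two points and could not end at the fixed point `r`.
  have hno2 : ∀ v, v ≠ r → f (f v) ≠ v := fun v hv h => by
    have hper : ∀ i : ℕ, f^[i] v = v ∨ f^[i] v = f v := by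
      intro i
      induction i with
      | zero => exact Or.inl rfl
      | succ i ih =>
        rw [Function.iterate_succ_apply']
        rcases ih with ih | ih
        · right; rw [ih]
        · left; rw [ih, h]
    obtain ⟨i, hi⟩ := hfr v
    rcases hper i with h' | h'
    · exact hv (by rw [← h', hi])
    · rw [← h', hi, hf] at h
      exact hv h.symm
  -- If `f` and `g` differ at `v`, the edge from `v` to `f v` must come from `g (f v) = v`, so they
  -- differ at `f v` too. The disagreement travels up to the root, where there is none.
  have hprop : ∀ v, f v ≠ g v → f (f v) ≠ g (f v) ∧ v ≠ r := by
    intro v hv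
    have hvr : v ≠ r := by
      rintro rfl
      exact hv (by rw [hf, hg])
    have hadj : (parentGraph g).Adj v (f v) :=
      hfg ▸ parentGraph_adj.2 ⟨(hno v hvr).symm, Or.inl rfl⟩
    obtain ⟨_, h | h⟩ := parentGraph_adj.1 hadj
    · exact absurd h.symm hv
    · exact ⟨by rw [h]; exact hno2 v hvr, hvr⟩
  funext v
  by_contra hv
  have hall : ∀ i : ℕ, f (f^[i] v) ≠ g (f^[i] v) := by
    intro i
    induction i with
    | zero => exact hv
    | succ i ih =>
      rw [Function.iterate_succ_apply']
      exact (hprop _ ih).1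
  obtain ⟨i, hi⟩ := hfr v
  exact (hprop _ (hall i)).2 hi

/-- Every tree arises from a parent map. -/
theorem SimpleGraph.IsTree.exists_parentGraph_eq {V : Type*} {G : SimpleGraph V} (hG : G.IsTree) :
    ∃ f : V → V, parentGraph f = G := by
  obtain ⟨r⟩ := hG.connected.nonempty
  -- The parent is the next vertex on a shortest path to the root.
  have hex : ∀ v, v ≠ r → ∃ w, G.Adj v w ∧ G.dist w r < G.dist v r := by
    intro v hv
    obtain ⟨p, hp⟩ := hG.connected.exists_walk_length_eq_dist v r
    cases p with
    | nil => exact absurd rfl hv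
    | cons h q =>
      refine ⟨_, h, ?_⟩
      rw [← hp, SimpleGraph.Walk.length_cons]
      exact Nat.lt_succ_of_le (SimpleGraph.dist_le q)
  choose! f hf using hex
  classical
  set g : V → V := fun v => if v = r then r else f v with hg
  have hgr : g r = r := by simp [hg]
  have hgv : ∀ v, v ≠ r → g v = f v := fun v hv => by simp [hg, hv]
  have hreach : ∀ n v, G.dist v r ≤ n → ∃ i : ℕ, g^[i] v = r := by
    intro n
    induction n with
    | zero =>
      intro v hv
      exact ⟨0, hG.connected.dist_eq_zero_iff.1 (Nat.le_zero.1 hv)⟩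
    | succ n ih =>
      intro v hv
      by_cases hvr : v = r
      · exact ⟨0, hvr⟩
      · obtain ⟨i, hi⟩ := ih (f v) (by have := (hf v hvr).2; omega)
        exact ⟨i + 1, by rw [Function.iterate_succ_apply, hgv v hvr, hi]⟩
  have hle : parentGraph g ≤ G := by
    intro u v huv
    have key : ∀ a b, a ≠ b → g a = b → G.Adj a b := by
      intro a b hab h
      have har : a ≠ r := by
        rintro rfl
        exact hab (by rw [← h, hgr])
      rw [← h, hgv a har]
      exact (hf a har).1
    obtain ⟨hne, h | h⟩ := parentGraph_adj.1 huv
    · exact key u v hne h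
    · exact (key v u hne.symm h).symm
  -- A tree is minimal among connected graphs, so its connected subgraph `parentGraph g` is the
  -- whole tree.
  exact ⟨g, le_antisymm hle ((SimpleGraph.isTree_iff_minimal_connected.1 hG).2
    (parentGraph_connected fun v => hreach _ v le_rfl) hle)⟩

open Classical in
/-- The trees on `V` in which every vertex has degree at most `d`. -/
noncomputable def boundedTrees (V : Type*) [Fintype V] (d : ℕ) : Finset (SimpleGraph V) :=
  {T | T.IsTree ∧ ∀ v, {w | T.Adj v w}.ncard ≤ d}

open Classical in
/-- The trees on `V`. -/
noncomputable def allTrees (V : Type*) [Fintype V] : Finset (SimpleGraph V) :=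
  {T | T.IsTree}

theorem mem_boundedTrees {V : Type*} [Fintype V] {d : ℕ} {T : SimpleGraph V} :
    T ∈ boundedTrees V d ↔ T.IsTree ∧ ∀ v, {w | T.Adj v w}.ncard ≤ d := by
  simp [boundedTrees]

theorem mem_allTrees {V : Type*} [Fintype V] {T : SimpleGraph V} :
    T ∈ allTrees V ↔ T.IsTree := by
  simp [allTrees]

/-- Weaker than Cayley's formula by a factor k², which is harmless against the exponential slack in
the first moment. -/
theorem card_allTrees_le (V : Type*) [Fintype V] :
    (allTrees V).card ≤ Fintype.card V ^ Fintype.card V := by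
  classical
  rw [← Fintype.card_fun, ← Finset.card_univ]
  refine (Finset.card_le_card ?_).trans (Finset.card_image_le (f := parentGraph))
  intro T hT
  obtain ⟨f, hf⟩ := (mem_allTrees.1 hT).exists_parentGraph_eq
  exact Finset.mem_image.2 ⟨f, Finset.mem_univ _, hf⟩

/-- A parent map is recovered from its root and its graph. Degrees are at most D + 1: D children and
one parent. -/
theorem card_parentMaps_le_boundedTrees (V : Type*) [Fintype V] [Nonempty V] (D : ℕ) :
    (parentMaps V D 1).card ≤ Fintype.card V * (boundedTrees V (D + 1)).card := by
  classical
  rw [← Finset.card_univ, ← Finset.card_product]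
  have hroot : ∀ f ∈ parentMaps V D 1, ∃ r, f r = r ∧ ∀ v, ∃ i : ℕ, f^[i] v = r := by
    intro f hf
    obtain ⟨h1, h2, -⟩ := mem_parentMaps.1 hf
    obtain ⟨r, hr⟩ := Finset.card_eq_one.1 h2
    have hfix : ∀ v, f v = v ↔ v = r := fun v => by
      have := Finset.ext_iff.1 hr v
      simpa using this
    refine ⟨r, (hfix r).2 rfl, fun v => ?_⟩
    obtain ⟨i, hi⟩ := h1 v
    exact ⟨i, (hfix _).1 hi⟩
  choose! r hr using hroot
  refine Finset.card_le_card_of_injOn (fun f => (r f, parentGraph f)) ?_ ?_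
  · intro f hf
    have hf' : f ∈ parentMaps V D 1 := hf
    refine Finset.mem_coe.2 (Finset.mem_product.2 ⟨Finset.mem_univ _, mem_boundedTrees.2
      ⟨parentGraph_isTree (hr f hf').1 (hr f hf').2, fun v => ?_⟩⟩)
    have hsub : {w | (parentGraph f).Adj v w} ⊆
        (insert (f v) (Finset.univ.filter fun u => f u = v ∧ u ≠ v) : Finset V) := by
      intro w hw
      obtain ⟨hne, h | h⟩ := parentGraph_adj.1 hw
      · simp [h]
      · simp [h, hne.symm]
    refine (Set.ncard_le_ncard hsub (Finset.finite_toSet _)).trans ?_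
    rw [Set.ncard_coe_finset]
    exact (Finset.card_insert_le _ _).trans
      (Nat.succ_le_succ ((mem_parentMaps.1 hf').2.2 v))
  · intro f hf g hg hfg
    have hf' : f ∈ parentMaps V D 1 := hf
    have hg' : g ∈ parentMaps V D 1 := hg
    simp only [Prod.mk.injEq] at hfg
    exact parentGraph_injective (hr f hf').1 (hfg.1 ▸ (hr g hg').1) (hr f hf').2 hfg.2

theorem card_boundedTrees_ge (V : Type*) [Fintype V] [Nonempty V] {D : ℕ} (hD : 0 < D) :
    ((1 - 1 / D : ℝ) * Fintype.card V) ^ (Fintype.card V - 1) ≤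
      Fintype.card V * (boundedTrees V (D + 1)).card := by
  have hpos : 0 < Fintype.card V := Fintype.card_pos
  have h := card_parentMaps_ge V hD (Fintype.card V - 1) (by omega)
  rw [Nat.choose_self, Nat.cast_one, mul_one,
    show Fintype.card V - (Fintype.card V - 1) = 1 by omega] at h
  exact h.trans (by exact_mod_cast card_parentMaps_le_boundedTrees V D)

/-! ### Traces of a graph on sets of pairs -/

/-- The pairs of distinct elements of `S`. -/
def pairSet {V : Type*} [DecidableEq V] (S : Finset V) : Finset (Sym2 V) :=
  S.sym2.filter fun e => ¬ e.IsDiag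

theorem mk_mem_pairSet {V : Type*} [DecidableEq V] {S : Finset V} {a b : V} :
    s(a, b) ∈ pairSet S ↔ a ∈ S ∧ b ∈ S ∧ a ≠ b := by
  simp [pairSet, and_assoc]

theorem card_pairSet {V : Type*} [DecidableEq V] (S : Finset V) :
    (pairSet S).card = S.card.choose 2 := by
  rw [← Sym2.card_image_offDiag]
  congr 1
  ext e
  induction e using Sym2.ind with
  | _ a b =>
    rw [mk_mem_pairSet]
    simp only [Finset.mem_image, Finset.mem_offDiag, Prod.exists]
    constructor
    · rintro ⟨h1, h2, h3⟩
      exact ⟨a, b, ⟨h1, h2, h3⟩, rfl⟩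
    · rintro ⟨c, d, ⟨h1, h2, h3⟩, h⟩
      have h' : s(c, d) = s(a, b) := h
      rcases Sym2.eq_iff.1 h' with ⟨rfl, rfl⟩ | ⟨rfl, rfl⟩
      · exact ⟨h1, h2, h3⟩
      · exact ⟨h2, h1, h3.symm⟩

theorem pairSet_inter {V : Type*} [DecidableEq V] (S S' : Finset V) :
    pairSet S ∩ pairSet S' = pairSet (S ∩ S') := by
  ext e
  induction e using Sym2.ind with
  | _ a b =>
    simp only [Finset.mem_inter, mk_mem_pairSet]
    tauto

theorem not_isDiag_of_mem_pairSet {V : Type*} [DecidableEq V] {S : Finset V} {e : Sym2 V}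
    (he : e ∈ pairSet S) : ¬ e.IsDiag := (Finset.mem_filter.1 he).2

section Cylinders

variable {V : Type*} [DecidableEq V]

/-- The graphs whose trace on the set of pairs `F` is `A`. -/
def traceEvent (F A : Finset (Sym2 V)) : Set (SimpleGraph V) :=
  {G | ∀ e ∈ F, e ∈ G.edgeSet ↔ e ∈ A}

theorem traceEvent_inter_eq_empty {F F' A A' : Finset (Sym2 V)} (h : A ∩ F' ≠ A' ∩ F)
    (hA : A ⊆ F) (hA' : A' ⊆ F') : traceEvent F A ∩ traceEvent F' A' = ∅ := by
  rw [Set.eq_empty_iff_forall_notMem]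
  rintro G ⟨h1, h2⟩
  refine h (Finset.ext fun e => ?_)
  simp only [Finset.mem_inter]
  constructor
  · rintro ⟨ha, hf⟩
    exact ⟨(h2 e hf).1 ((h1 e (hA ha)).2 ha), hA ha⟩
  · rintro ⟨ha, hf⟩
    exact ⟨(h1 e hf).1 ((h2 e (hA' ha)).2 ha), hA' ha⟩

theorem traceEvent_inter_subset (F F' A A' : Finset (Sym2 V)) (h : A ∩ F' = A' ∩ F) :
    traceEvent F A ∩ traceEvent F' A' ⊆ traceEvent (F ∪ F') (A ∪ A') := by
  rintro G ⟨h1, h2⟩ e he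
  have h3 : e ∈ A ∧ e ∈ F' ↔ e ∈ A' ∧ e ∈ F := by
    rw [← Finset.mem_inter, h, Finset.mem_inter]
  have h1 := h1 e
  have h2 := h2 e
  simp only [Finset.mem_union] at he ⊢
  tauto

/-- Compatibility fixes A' ∩ F, so A' is determined by A' \ F. As A and A' have equal size, this is
a subset of F' \ F with exactly |A \ F'| elements. -/
theorem card_filter_inter_eq_le (𝒜 : Finset (Finset (Sym2 V))) {F F' A : Finset (Sym2 V)}
    {m s M : ℕ} (h𝒜 : ∀ A' ∈ 𝒜, A' ⊆ F' ∧ A'.card = m) (hAm : A.card = m)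
    (hs : (A \ F').card ≤ s) (hM : (F' \ F).card ≤ M) (hM1 : 1 ≤ M) :
    (𝒜.filter fun A' => A ∩ F' = A' ∩ F).card ≤ M ^ s := by
  have h1 : (𝒜.filter fun A' => A ∩ F' = A' ∩ F).card ≤
      ((F' \ F).powersetCard (A \ F').card).card := by
    refine Finset.card_le_card_of_injOn (fun A' => A' \ F) ?_ ?_
    · intro A' hA'
      obtain ⟨hA', h⟩ := Finset.mem_filter.1 hA'
      refine Finset.mem_coe.2 (Finset.mem_powersetCard.2
        ⟨Finset.sdiff_subset_sdiff (h𝒜 A' hA').1 le_rfl, ?_⟩)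
      have h2 := Finset.card_sdiff_add_card_inter A F'
      have h3 := Finset.card_sdiff_add_card_inter A' F
      rw [← h] at h3
      have := (h𝒜 A' hA').2
      dsimp only
      omega
    · intro A' hA' A'' hA'' h
      obtain ⟨hA', h1⟩ := Finset.mem_filter.1 hA'
      obtain ⟨hA'', h2⟩ := Finset.mem_filter.1 hA''
      have h : A' \ F = A'' \ F := h
      rw [← Finset.sdiff_union_inter A' F, ← Finset.sdiff_union_inter A'' F, h, ← h1, ← h2]
  refine h1.trans ?_
  rw [Finset.card_powersetCard]
  calc _ ≤ (F' \ F).card ^ (A \ F').card := Nat.choose_le_pow _ _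
    _ ≤ M ^ (A \ F').card := Nat.pow_le_pow_left hM _
    _ ≤ M ^ s := Nat.pow_le_pow_right hM1 hs

variable [Fintype V] (p : unitInterval)

theorem traceEvent_real {F A : Finset (Sym2 V)} (hF : ∀ e ∈ F, ¬ e.IsDiag) (hA : A ⊆ F) :
    (SimpleGraph.binomialRandom V p).real (traceEvent F A) =
      (p : ℝ) ^ A.card * (1 - p : ℝ) ^ (F.card - A.card) :=
  binomialRandom_real_trace p hF hA

theorem traceEvent_inter_real_le {F F' A A' : Finset (Sym2 V)} (hF : ∀ e ∈ F, ¬ e.IsDiag)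
    (hF' : ∀ e ∈ F', ¬ e.IsDiag) (hA : A ⊆ F) (hA' : A' ⊆ F') (h : A ∩ F' = A' ∩ F) :
    (SimpleGraph.binomialRandom V p).real (traceEvent F A ∩ traceEvent F' A') ≤
      (p : ℝ) ^ (A ∪ A').card * (1 - p : ℝ) ^ ((F ∪ F').card - (A ∪ A').card) := by
  rw [← traceEvent_real p (F := F ∪ F') (A := A ∪ A')
    (by intro e he; rcases Finset.mem_union.1 he with h | h; exacts [hF e h, hF' e h])
    (Finset.union_subset_union hA hA')]
  exact MeasureTheory.measureReal_mono (traceEvent_inter_subset F F' A A' h)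

/-- Two traces that share few pairs are almost independent. -/
theorem traceEvent_inter_real_le_sq {F F' A A' : Finset (Sym2 V)} {m K c t : ℕ} (hp0 : 0 < p)
    (hp1 : p < 1) (hF : ∀ e ∈ F, ¬ e.IsDiag) (hF' : ∀ e ∈ F', ¬ e.IsDiag) (hA : A ⊆ F)
    (hA' : A' ⊆ F') (hAm : A.card = m) (hAm' : A'.card = m) (hK : F.card = K) (hK' : F'.card = K)
    (hc : (F ∩ F').card = c) (ht : (A ∩ F').card ≤ t) :
    (SimpleGraph.binomialRandom V p).real (traceEvent F A ∩ traceEvent F' A') ≤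
      ((p : ℝ) ^ m * (1 - p : ℝ) ^ (K - m)) ^ 2 / ((p : ℝ) ^ t * (1 - p : ℝ) ^ c) := by
  have hp0' : (0 : ℝ) < p := hp0
  have hp1' : (p : ℝ) < 1 := hp1
  have hq0 : (0 : ℝ) < 1 - p := by linarith
  have hq1 : (1 - p : ℝ) ≤ 1 := by linarith
  by_cases h : A ∩ F' = A' ∩ F
  swap
  · rw [traceEvent_inter_eq_empty h hA hA']
    simp only [MeasureTheory.measureReal_empty]
    positivity
  refine (traceEvent_inter_real_le p hF hF' hA hA' h).trans ?_
  rw [le_div_iff₀ (by positivity)]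
  have hr : (A ∩ A').card ≤ t := by
    refine le_trans (Finset.card_le_card ?_) ht
    exact Finset.inter_subset_inter_left hA'
  have hrc : (A ∩ A').card ≤ c := hc ▸ Finset.card_le_card (Finset.inter_subset_inter hA hA')
  have h1 := Finset.card_union_add_card_inter A A'
  have h2 := Finset.card_union_add_card_inter F F'
  have h3 := Finset.card_le_card (Finset.union_subset_union hA hA')
  have h4 := Finset.card_le_card hA
  -- The exponents compare because |A ∪ A'| + t ≥ 2m and |F ∪ F'| + c = 2K.
  calc (p : ℝ) ^ (A ∪ A').card * (1 - p : ℝ) ^ ((F ∪ F').card - (A ∪ A').card) *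
        ((p : ℝ) ^ t * (1 - p : ℝ) ^ c)
      = (p : ℝ) ^ ((A ∪ A').card + t) *
          (1 - p : ℝ) ^ ((F ∪ F').card - (A ∪ A').card + c) := by ring
    _ ≤ (p : ℝ) ^ (m * 2) * (1 - p : ℝ) ^ ((K - m) * 2) := by
        refine mul_le_mul (pow_le_pow_of_le_one hp0'.le hp1'.le (by omega))
          (pow_le_pow_of_le_one hq0.le hq1 (by omega)) (by positivity) (by positivity)
    _ = _ := by ring

/-- The probability of two traces sharing most of their pairs. -/
theorem traceEvent_inter_real_le_of_inter_eq {F F' A A' : Finset (Sym2 V)} {m K c s : ℕ}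
    (hp0 : 0 < p) (hp1 : p < 1) (hF : ∀ e ∈ F, ¬ e.IsDiag) (hF' : ∀ e ∈ F', ¬ e.IsDiag)
    (hA : A ⊆ F) (hA' : A' ⊆ F') (hAm : A.card = m) (hAm' : A'.card = m) (hK : F.card = K)
    (hK' : F'.card = K) (hc : (F ∩ F').card = c) (hs : (A \ F').card ≤ s) (h : A ∩ F' = A' ∩ F) :
    (SimpleGraph.binomialRandom V p).real (traceEvent F A ∩ traceEvent F' A') ≤
      ((p : ℝ) ^ m * (1 - p : ℝ) ^ (K - m)) * ((1 - p : ℝ) ^ (K - c) / (1 - p : ℝ) ^ s) := by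
  have hp0' : (0 : ℝ) < p := hp0
  have hp1' : (p : ℝ) < 1 := hp1
  have hq0 : (0 : ℝ) < 1 - p := by linarith
  have hq1 : (1 - p : ℝ) ≤ 1 := by linarith
  refine (traceEvent_inter_real_le p hF hF' hA hA' h).trans ?_
  rw [← mul_div_assoc, le_div_iff₀ (by positivity)]
  -- For compatible traces the common edges are all the edges of A inside F', which gives |A ∪ A'| =
  -- m + |A \ F'|.
  have h0 : A ∩ A' = A ∩ F' := by
    refine le_antisymm (Finset.inter_subset_inter_left hA') ?_
    refine Finset.subset_inter Finset.inter_subset_left ?_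
    rw [h]
    exact Finset.inter_subset_left
  have h1 := Finset.card_union_add_card_inter A A'
  have h2 := Finset.card_union_add_card_inter F F'
  have h3 := Finset.card_le_card (Finset.union_subset_union hA hA')
  have h4 := Finset.card_le_card hA
  have h5 := Finset.card_sdiff_add_card_inter A F'
  have h6 : c ≤ K := by
    rw [← hc, ← hK]
    exact Finset.card_le_card Finset.inter_subset_left
  rw [h0] at h1
  calc (p : ℝ) ^ (A ∪ A').card * (1 - p : ℝ) ^ ((F ∪ F').card - (A ∪ A').card) * (1 - p : ℝ) ^ s
      = (p : ℝ) ^ (A ∪ A').card *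
          (1 - p : ℝ) ^ ((F ∪ F').card - (A ∪ A').card + s) := by ring
    _ ≤ (p : ℝ) ^ m * (1 - p : ℝ) ^ (K - m + (K - c)) := by
        refine mul_le_mul (pow_le_pow_of_le_one hp0'.le hp1'.le (by omega))
          (pow_le_pow_of_le_one hq0.le hq1 (by omega)) (by positivity) (by positivity)
    _ = _ := by ring

end Cylinders

/-! ### Copies of trees on vertex subsets -/

section Copies

variable {V : Type*} [Fintype V] {k : ℕ}

/-- The edges of the copy of `T` along `φ`. -/
noncomputable def copyEdges (φ : Fin k ↪ V) (T : SimpleGraph (Fin k)) : Finset (Sym2 V) :=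
  (Set.toFinite (T.map φ).edgeSet).toFinset

theorem mk_mem_copyEdges {φ : Fin k ↪ V} {T : SimpleGraph (Fin k)} {a b : V} :
    s(a, b) ∈ copyEdges φ T ↔ ∃ u v, T.Adj u v ∧ φ u = a ∧ φ v = b := by
  simp [copyEdges]

theorem mk_map_mem_copyEdges {φ : Fin k ↪ V} {T : SimpleGraph (Fin k)} {u v : Fin k} :
    s(φ u, φ v) ∈ copyEdges φ T ↔ T.Adj u v := by
  simp [copyEdges]

theorem copyEdges_injective (φ : Fin k ↪ V) : Function.Injective (copyEdges φ) := by
  intro T T' h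
  ext u v
  rw [← mk_map_mem_copyEdges (φ := φ), h, mk_map_mem_copyEdges]

theorem card_copyEdges (φ : Fin k ↪ V) {T : SimpleGraph (Fin k)} (hT : T.IsTree) :
    (copyEdges φ T).card = k - 1 := by
  have h := (SimpleGraph.isTree_iff_connected_and_card.1 hT).2
  rw [Nat.card_eq_fintype_card (α := Fin k), Fintype.card_fin, Nat.card_coe_set_eq] at h
  rw [copyEdges, ← Set.ncard_eq_toFinset_card, SimpleGraph.edgeSet_map,
    Set.ncard_image_of_injective _ φ.sym2Map.injective]
  omega

variable [DecidableEq V]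

theorem copyEdges_subset (φ : Fin k ↪ V) (T : SimpleGraph (Fin k)) :
    copyEdges φ T ⊆ pairSet (Finset.univ.map φ) := by
  intro e
  induction e using Sym2.ind with
  | _ a b =>
    intro h
    obtain ⟨u, v, huv, rfl, rfl⟩ := mk_mem_copyEdges.1 h
    simp [mk_mem_pairSet, huv.ne]

theorem comap_eq_iff_mem_traceEvent (φ : Fin k ↪ V) (T : SimpleGraph (Fin k))
    (G : SimpleGraph V) :
    G.comap φ = T ↔ G ∈ traceEvent (pairSet (Finset.univ.map φ)) (copyEdges φ T) := by
  constructor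
  · rintro rfl e
    induction e using Sym2.ind with
    | _ a b =>
      intro h
      obtain ⟨ha, hb, -⟩ := mk_mem_pairSet.1 h
      obtain ⟨u, -, rfl⟩ := Finset.mem_map.1 ha
      obtain ⟨v, -, rfl⟩ := Finset.mem_map.1 hb
      rw [mk_map_mem_copyEdges]
      rfl
  · intro h
    ext u v
    by_cases huv : u = v
    · simp [huv]
    · have := h s(φ u, φ v) (by simp [mk_mem_pairSet, huv])
      rw [mk_map_mem_copyEdges] at this
      exact this

/-- In a graph of bounded degree a small vertex set meets few edges. -/
theorem card_copyEdges_meeting_le (φ : Fin k ↪ V) {T : SimpleGraph (Fin k)} {d : ℕ}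
    (hT : ∀ v, {w | T.Adj v w}.ncard ≤ d) (D : Finset V) {B : Finset (Sym2 V)}
    (hB : B ⊆ copyEdges φ T) (hBD : ∀ e ∈ B, ∃ v ∈ D, v ∈ e) : B.card ≤ d * D.card := by
  have hdeg : ∀ v : V, ((copyEdges φ T).filter fun e => v ∈ e).card ≤ d := by
    intro v
    by_cases hv : ∃ u, φ u = v
    · obtain ⟨u, rfl⟩ := hv
      have hsub : ((copyEdges φ T).filter fun e => φ u ∈ e : Finset (Sym2 V)) ⊆
          ((Set.toFinite {w | T.Adj u w}).toFinset).image fun w => s(φ u, φ w) := by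
        intro e he
        obtain ⟨he, hue⟩ := Finset.mem_filter.1 he
        obtain ⟨b, rfl⟩ := hue
        obtain ⟨x, y, hxy, hx, rfl⟩ := mk_mem_copyEdges.1 he
        obtain rfl := φ.injective hx
        exact Finset.mem_image.2 ⟨y, by simpa using hxy, rfl⟩
      refine (Finset.card_le_card hsub).trans (Finset.card_image_le.trans ?_)
      rw [← Set.ncard_eq_toFinset_card]
      exact hT u
    · rw [Finset.card_eq_zero.2]
      · exact Nat.zero_le _
      · refine Finset.filter_eq_empty_iff.2 ?_
        rintro e he ⟨b, rfl⟩
        obtain ⟨x, y, hxy, hx, rfl⟩ := mk_mem_copyEdges.1 he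
        exact hv ⟨x, hx⟩
  have hsub : B ⊆ D.biUnion fun v => (copyEdges φ T).filter fun e => v ∈ e := by
    intro e he
    obtain ⟨v, hv, hve⟩ := hBD e he
    exact Finset.mem_biUnion.2 ⟨v, hv, Finset.mem_filter.2 ⟨hB he, hve⟩⟩
  refine (Finset.card_le_card hsub).trans (Finset.card_biUnion_le.trans ?_)
  refine (Finset.sum_le_sum fun v _ => hdeg v).trans ?_
  rw [Finset.sum_const, smul_eq_mul, mul_comm]

theorem card_copyEdges_inter_pairSet_le (φ : Fin k ↪ V) {T : SimpleGraph (Fin k)} {d : ℕ}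
    (hT : ∀ v, {w | T.Adj v w}.ncard ≤ d) (S' : Finset V) :
    (copyEdges φ T ∩ pairSet S').card ≤ d * (Finset.univ.map φ ∩ S').card := by
  refine card_copyEdges_meeting_le φ hT _ Finset.inter_subset_left ?_
  intro e
  induction e using Sym2.ind with
  | _ a b =>
    intro he
    obtain ⟨h1, h2⟩ := Finset.mem_inter.1 he
    exact ⟨a, Finset.mem_inter.2 ⟨(mk_mem_pairSet.1 (copyEdges_subset φ T h1)).1,
      (mk_mem_pairSet.1 h2).1⟩, Sym2.mem_mk_left a b⟩

/-- An edge not inside S' has an endpoint outside it. Without the degree bound one such vertex could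
carry every edge, as in a star. -/
theorem card_copyEdges_sdiff_pairSet_le (φ : Fin k ↪ V) {T : SimpleGraph (Fin k)} {d : ℕ}
    (hT : ∀ v, {w | T.Adj v w}.ncard ≤ d) (S' : Finset V) :
    (copyEdges φ T \ pairSet S').card ≤ d * (Finset.univ.map φ \ S').card := by
  refine card_copyEdges_meeting_le φ hT _ Finset.sdiff_subset ?_
  intro e
  induction e using Sym2.ind with
  | _ a b =>
    intro he
    obtain ⟨h1, h2⟩ := Finset.mem_sdiff.1 he
    obtain ⟨ha, hb, hab⟩ := mk_mem_pairSet.1 (copyEdges_subset φ T h1)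
    by_cases haS : a ∈ S'
    · refine ⟨b, Finset.mem_sdiff.2 ⟨hb, fun hbS => ?_⟩, Sym2.mem_mk_right a b⟩
      exact h2 (mk_mem_pairSet.2 ⟨haS, hbS, hab⟩)
    · exact ⟨a, Finset.mem_sdiff.2 ⟨ha, haS⟩, Sym2.mem_mk_left a b⟩

/-- The graphs whose pullback along `φ` lies in `𝒢`. -/
def pullbackEvent (φ : Fin k ↪ V) (𝒢 : Finset (SimpleGraph (Fin k))) : Set (SimpleGraph V) :=
  {G | G.comap φ ∈ 𝒢}

theorem pullbackEvent_eq_biUnion (φ : Fin k ↪ V) (𝒢 : Finset (SimpleGraph (Fin k))) :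
    pullbackEvent φ 𝒢 =
      ⋃ T ∈ 𝒢, traceEvent (pairSet (Finset.univ.map φ)) (copyEdges φ T) := by
  ext G
  simp only [pullbackEvent, Set.mem_ofPred_eq, Set.mem_iUnion, ← comap_eq_iff_mem_traceEvent]
  simp

variable (p : unitInterval)

theorem pullbackEvent_real (φ : Fin k ↪ V) {𝒢 : Finset (SimpleGraph (Fin k))}
    (h𝒢 : ∀ T ∈ 𝒢, T.IsTree) :
    (SimpleGraph.binomialRandom V p).real (pullbackEvent φ 𝒢) =
      𝒢.card * ((p : ℝ) ^ (k - 1) * (1 - p : ℝ) ^ (k.choose 2 - (k - 1))) := by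
  rw [pullbackEvent_eq_biUnion, MeasureTheory.measureReal_biUnion_finset]
  · rw [← nsmul_eq_mul, ← Finset.sum_const]
    refine Finset.sum_congr rfl fun T hT => ?_
    rw [traceEvent_real p (fun e he => not_isDiag_of_mem_pairSet he) (copyEdges_subset φ T),
      card_copyEdges φ (h𝒢 T hT), card_pairSet, Finset.card_map, Finset.card_univ,
      Fintype.card_fin]
  · intro T _ T' _ hne
    refine Set.disjoint_left.2 fun G h1 h2 => hne ?_
    rw [← (comap_eq_iff_mem_traceEvent φ T G).2 h1, (comap_eq_iff_mem_traceEvent φ T' G).2 h2]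
  · exact fun T _ => .of_discrete

theorem pullbackEvent_inter_real_le_sum (φ φ' : Fin k ↪ V) (𝒢 : Finset (SimpleGraph (Fin k))) :
    (SimpleGraph.binomialRandom V p).real (pullbackEvent φ 𝒢 ∩ pullbackEvent φ' 𝒢) ≤
      ∑ T ∈ 𝒢, ∑ T' ∈ 𝒢, (SimpleGraph.binomialRandom V p).real
        (traceEvent (pairSet (Finset.univ.map φ)) (copyEdges φ T) ∩
          traceEvent (pairSet (Finset.univ.map φ')) (copyEdges φ' T')) := by
  have : pullbackEvent φ 𝒢 ∩ pullbackEvent φ' 𝒢 = ⋃ T ∈ 𝒢, ⋃ T' ∈ 𝒢,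
      (traceEvent (pairSet (Finset.univ.map φ)) (copyEdges φ T) ∩
          traceEvent (pairSet (Finset.univ.map φ')) (copyEdges φ' T')) := by
    rw [pullbackEvent_eq_biUnion, pullbackEvent_eq_biUnion]
    ext G
    simp only [Set.mem_inter_iff, Set.mem_iUnion]
    constructor
    · rintro ⟨⟨T, hT, h⟩, T', hT', h'⟩
      exact ⟨T, hT, T', hT', h, h'⟩
    · rintro ⟨T, hT, T', hT', h, h'⟩
      exact ⟨⟨T, hT, h⟩, T', hT', h'⟩
  rw [this]
  refine (MeasureTheory.measureReal_biUnion_finset_le _ _).trans ?_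
  exact Finset.sum_le_sum fun T _ => MeasureTheory.measureReal_biUnion_finset_le _ _

variable {𝒢 : Finset (SimpleGraph (Fin k))} {d : ℕ}

/-- The parameter `t` bounds the number of shared edges. For l ≤ 1 it can be 0, which makes the
covariance nonpositive; for larger l it is taken to be dl. -/
theorem pullbackEvent_inter_real_le_sq (hp0 : 0 < p) (hp1 : p < 1) (φ φ' : Fin k ↪ V)
    (h𝒢 : ∀ T ∈ 𝒢, T.IsTree ∧ ∀ v, {w | T.Adj v w}.ncard ≤ d) {l : ℕ}
    (hl : (Finset.univ.map φ ∩ Finset.univ.map φ').card = l) {t : ℕ}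
    (ht : min (d * l) (l.choose 2) ≤ t) :
    (SimpleGraph.binomialRandom V p).real (pullbackEvent φ 𝒢 ∩ pullbackEvent φ' 𝒢) ≤
      (𝒢.card * ((p : ℝ) ^ (k - 1) * (1 - p : ℝ) ^ (k.choose 2 - (k - 1)))) ^ 2 /
        ((p : ℝ) ^ t * (1 - p : ℝ) ^ l.choose 2) := by
  refine (pullbackEvent_inter_real_le_sum p φ φ' 𝒢).trans ?_
  have hterm : ∀ T ∈ 𝒢, ∀ T' ∈ 𝒢, (SimpleGraph.binomialRandom V p).real
        (traceEvent (pairSet (Finset.univ.map φ)) (copyEdges φ T) ∩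
          traceEvent (pairSet (Finset.univ.map φ')) (copyEdges φ' T')) ≤
      ((p : ℝ) ^ (k - 1) * (1 - p : ℝ) ^ (k.choose 2 - (k - 1))) ^ 2 /
        ((p : ℝ) ^ t * (1 - p : ℝ) ^ l.choose 2) := by
    intro T hT T' hT'
    refine traceEvent_inter_real_le_sq p hp0 hp1 (fun e he => not_isDiag_of_mem_pairSet he)
      (fun e he => not_isDiag_of_mem_pairSet he) (copyEdges_subset _ _) (copyEdges_subset _ _)
      (card_copyEdges φ (h𝒢 T hT).1) (card_copyEdges φ' (h𝒢 T' hT').1) ?_ ?_ ?_ ?_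
    · simp [card_pairSet]
    · simp [card_pairSet]
    · rw [pairSet_inter, card_pairSet, hl]
    · refine le_trans (le_min ?_ ?_) ht
      · rw [← hl]
        exact card_copyEdges_inter_pairSet_le φ (h𝒢 T hT).2 _
      · rw [← hl, ← card_pairSet, ← pairSet_inter]
        exact Finset.card_le_card (Finset.inter_subset_inter_right (copyEdges_subset φ T))
  refine (Finset.sum_le_sum fun T hT => Finset.sum_le_sum fun T' hT' => hterm T hT T' hT').trans ?_
  rw [Finset.sum_const, Finset.sum_const, nsmul_eq_mul, nsmul_eq_mul]
  exact le_of_eq (by ring)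

/-- Only one factor |𝒢| appears: for each T, compatibility leaves at most k^{2d(k-l)} choices of T',
and all other pairs of trees contribute the empty event. -/
theorem pullbackEvent_inter_real_le_of_large (hp0 : 0 < p) (hp1 : p < 1) (φ φ' : Fin k ↪ V)
    (h𝒢 : ∀ T ∈ 𝒢, T.IsTree ∧ ∀ v, {w | T.Adj v w}.ncard ≤ d) (hk : 1 ≤ k) {l : ℕ}
    (hl : (Finset.univ.map φ ∩ Finset.univ.map φ').card = l) :
    (SimpleGraph.binomialRandom V p).real (pullbackEvent φ 𝒢 ∩ pullbackEvent φ' 𝒢) ≤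
      (𝒢.card * ((p : ℝ) ^ (k - 1) * (1 - p : ℝ) ^ (k.choose 2 - (k - 1)))) *
        ((k : ℝ) ^ (2 * (d * (k - l))) *
          ((1 - p : ℝ) ^ (k.choose 2 - l.choose 2) / (1 - p : ℝ) ^ (d * (k - l)))) := by
  have hp0' : (0 : ℝ) < p := hp0
  have hp1' : (p : ℝ) < 1 := hp1
  have hq0 : (0 : ℝ) < 1 - p := by linarith
  refine (pullbackEvent_inter_real_le_sum p φ φ' 𝒢).trans ?_
  set R : ℝ := ((p : ℝ) ^ (k - 1) * (1 - p : ℝ) ^ (k.choose 2 - (k - 1))) *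
    ((1 - p : ℝ) ^ (k.choose 2 - l.choose 2) / (1 - p : ℝ) ^ (d * (k - l))) with hR
  have hR0 : 0 ≤ R := by positivity
  have hcardφ : ∀ ψ : Fin k ↪ V, (Finset.univ.map ψ).card = k := fun ψ => by simp
  have hsd : ∀ T ∈ 𝒢, (copyEdges φ T \ pairSet (Finset.univ.map φ')).card ≤ d * (k - l) := by
    intro T hT
    refine (card_copyEdges_sdiff_pairSet_le φ (h𝒢 T hT).2 _).trans ?_
    have := Finset.card_sdiff_add_card_inter (Finset.univ.map φ) (Finset.univ.map φ')
    rw [hl, hcardφ] at this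
    exact Nat.mul_le_mul_left _ (by omega)
  have hin : ∀ T ∈ 𝒢, ∑ T' ∈ 𝒢, (SimpleGraph.binomialRandom V p).real
        (traceEvent (pairSet (Finset.univ.map φ)) (copyEdges φ T) ∩
          traceEvent (pairSet (Finset.univ.map φ')) (copyEdges φ' T')) ≤
      (k : ℝ) ^ (2 * (d * (k - l))) * R := by
    intro T hT
    set C := 𝒢.filter fun T' => copyEdges φ T ∩ pairSet (Finset.univ.map φ') =
      copyEdges φ' T' ∩ pairSet (Finset.univ.map φ) with hC
    have hcount : C.card ≤ (k ^ 2) ^ (d * (k - l)) := by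
      have h := card_filter_inter_eq_le (𝒢.image (copyEdges φ'))
        (F := pairSet (Finset.univ.map φ)) (F' := pairSet (Finset.univ.map φ'))
        (A := copyEdges φ T) (m := k - 1) (s := d * (k - l)) (M := k ^ 2) ?_
        (card_copyEdges φ (h𝒢 T hT).1) (hsd T hT) ?_ (Nat.one_le_pow _ _ hk)
      · refine le_trans ?_ h
        rw [Finset.filter_image, Finset.card_image_of_injective _ (copyEdges_injective φ')]
      · intro A' hA'
        obtain ⟨T', hT', rfl⟩ := Finset.mem_image.1 hA'
        exact ⟨copyEdges_subset φ' T', card_copyEdges φ' (h𝒢 T' hT').1⟩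
      · refine (Finset.card_le_card Finset.sdiff_subset).trans ?_
        rw [card_pairSet, hcardφ]
        exact Nat.choose_le_pow _ _
    calc _ ≤ ∑ T' ∈ 𝒢, if copyEdges φ T ∩ pairSet (Finset.univ.map φ') =
            copyEdges φ' T' ∩ pairSet (Finset.univ.map φ) then R else 0 := by
          refine Finset.sum_le_sum fun T' hT' => ?_
          split_ifs with h
          · refine traceEvent_inter_real_le_of_inter_eq p hp0 hp1
              (fun e he => not_isDiag_of_mem_pairSet he)
              (fun e he => not_isDiag_of_mem_pairSet he) (copyEdges_subset _ _)
              (copyEdges_subset _ _) (card_copyEdges φ (h𝒢 T hT).1)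
              (card_copyEdges φ' (h𝒢 T' hT').1) ?_ ?_ ?_ (hsd T hT) h
            · simp [card_pairSet]
            · simp [card_pairSet]
            · rw [pairSet_inter, card_pairSet, hl]
          · rw [traceEvent_inter_eq_empty h (copyEdges_subset _ _) (copyEdges_subset _ _)]
            simp
      _ = C.card * R := by
          rw [← Finset.sum_filter, Finset.sum_const, nsmul_eq_mul]
      _ ≤ _ := by
          refine mul_le_mul_of_nonneg_right ?_ hR0
          rw [pow_mul]
          exact_mod_cast hcount
  refine (Finset.sum_le_sum hin).trans ?_
  rw [Finset.sum_const, nsmul_eq_mul, hR]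
  exact le_of_eq (by ring)

end Copies

/-! ### The two moment bounds for induced trees -/

theorem card_filter_inter_card_le {V : Type*} [Fintype V] [DecidableEq V] {k : ℕ} {S : Finset V}
    (hS : S.card = k) (l : ℕ) :
    ((Finset.univ.powersetCard k).filter fun S' => (S ∩ S').card = l).card ≤
      k.choose l * (Fintype.card V - k).choose (k - l) := by
  rw [← hS, ← Finset.card_compl, ← Finset.card_powersetCard, ← Finset.card_powersetCard,
    ← Finset.card_product]
  refine Finset.card_le_card_of_injOn (fun S' => (S ∩ S', S' \ S)) ?_ ?_
  · intro S' hS'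
    obtain ⟨h1, h2⟩ := Finset.mem_filter.1 hS'
    have h3 := (Finset.mem_powersetCard.1 h1).2
    have h4 := Finset.card_sdiff_add_card_inter S' S
    rw [Finset.inter_comm] at h4
    refine Finset.mem_coe.2 (Finset.mem_product.2 ⟨Finset.mem_powersetCard.2
      ⟨Finset.inter_subset_left, h2⟩, Finset.mem_powersetCard.2 ⟨fun x hx => ?_, ?_⟩⟩)
    · simpa using (Finset.mem_sdiff.1 hx).2
    · dsimp only
      omega
  · intro S' _ S'' _ h
    simp only [Prod.mk.injEq] at h
    rw [← Finset.sdiff_union_inter S' S, ← Finset.sdiff_union_inter S'' S, h.2,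
      Finset.inter_comm S', Finset.inter_comm S'', h.1]

/-- The second moment bound for copies of the graphs in `𝒢`. -/
theorem no_pullback_real_le {V : Type*} [Fintype V] [DecidableEq V] (p : unitInterval)
    (hp0 : 0 < p) (hp1 : p < 1) {k d : ℕ} (hk : 1 ≤ k) (hkV : k ≤ Fintype.card V)
    {𝒢 : Finset (SimpleGraph (Fin k))}
    (h𝒢 : ∀ T ∈ 𝒢, T.IsTree ∧ ∀ v, {w | T.Adj v w}.ncard ≤ d) (hne : 𝒢.Nonempty)
    (φ : Finset V → (Fin k ↪ V)) (hφ : ∀ S : Finset V, S.card = k → Finset.univ.map (φ S) = S)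
    {x : ℝ} (hx : 0 ≤ x)
    (hsmall : ∀ l, 2 ≤ l → 2 * l ≤ k →
      ((k.choose l * (Fintype.card V - k).choose (k - l) : ℕ) : ℝ) /
        ((p : ℝ) ^ (d * l) * (1 - p : ℝ) ^ l.choose 2) ≤ x * (Fintype.card V).choose k)
    (hlarge : ∀ l, l ≤ k → k < 2 * l →
      ((k.choose l * (Fintype.card V - k).choose (k - l) : ℕ) : ℝ) *
        ((k : ℝ) ^ (2 * (d * (k - l))) *
          ((1 - p : ℝ) ^ (k.choose 2 - l.choose 2) / (1 - p : ℝ) ^ (d * (k - l)))) ≤ 1) :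
    (SimpleGraph.binomialRandom V p).real
        {G | ∀ S ∈ Finset.univ.powersetCard k, G ∉ pullbackEvent (φ S) 𝒢} ≤
      (k + 1) * (x + 1 / ((Fintype.card V).choose k *
        (𝒢.card * ((p : ℝ) ^ (k - 1) * (1 - p : ℝ) ^ (k.choose 2 - (k - 1)))))) := by
  have hp0' : (0 : ℝ) < p := hp0
  have hp1' : (p : ℝ) < 1 := hp1
  have hq0 : (0 : ℝ) < 1 - p := by linarith
  set μ := SimpleGraph.binomialRandom V p
  set P : ℝ := 𝒢.card * ((p : ℝ) ^ (k - 1) * (1 - p : ℝ) ^ (k.choose 2 - (k - 1))) with hP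
  have hPpos : 0 < P := by
    have : (0 : ℝ) < 𝒢.card := by exact_mod_cast hne.card_pos
    positivity
  set N : ℝ := (((Fintype.card V).choose k : ℕ) : ℝ) with hN
  have hNpos : 0 < N := by
    rw [hN]
    exact_mod_cast Nat.choose_pos hkV
  set s : Finset (Finset V) := Finset.univ.powersetCard k with hs
  have hscard : (s.card : ℝ) = N := by
    rw [hs, Finset.card_powersetCard, Finset.card_univ]
  have hprob : ∀ S, μ.real (pullbackEvent (φ S) 𝒢) = P := fun S =>
    pullbackEvent_real p (φ S) fun T hT => (h𝒢 T hT).1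
  have h2 := secondMoment_bound μ s (fun S => pullbackEvent (φ S) 𝒢) fun _ _ => .of_discrete
  simp only [hprob, Finset.sum_const, nsmul_eq_mul] at h2
  rw [hscard] at h2
  -- A covariance bound depending only on the overlap l, with separate estimates for l ≤ 1, l ≤ k/2
  -- and l > k/2.
  set b : ℕ → ℝ := fun l => if l ≤ 1 then 0 else if 2 * l ≤ k then
      P ^ 2 / ((p : ℝ) ^ (d * l) * (1 - p : ℝ) ^ l.choose 2) else
      P * ((k : ℝ) ^ (2 * (d * (k - l))) *
          ((1 - p : ℝ) ^ (k.choose 2 - l.choose 2) / (1 - p : ℝ) ^ (d * (k - l)))) with hb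
  have hterm : ∀ S ∈ s, ∀ S' ∈ s,
      μ.real (pullbackEvent (φ S) 𝒢 ∩ pullbackEvent (φ S') 𝒢) - P * P ≤ b (S ∩ S').card := by
    intro S hS S' hS'
    have hSφ := hφ S (Finset.mem_powersetCard.1 hS).2
    have hSφ' := hφ S' (Finset.mem_powersetCard.1 hS').2
    have hl : (Finset.univ.map (φ S) ∩ Finset.univ.map (φ S')).card = (S ∩ S').card := by
      rw [hSφ, hSφ']
    have hPP : 0 ≤ P * P := by positivity
    simp only [hb]
    split_ifs with h1 h2
    · have h0 : (S ∩ S').card.choose 2 = 0 := Nat.choose_eq_zero_of_lt (by omega)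
      have := pullbackEvent_inter_real_le_sq p hp0 hp1 (φ S) (φ S') h𝒢 hl (t := 0) (by simp [h0])
      rw [h0, ← hP] at this
      simp only [pow_zero, mul_one, div_one] at this
      linarith [sq P]
    · have := pullbackEvent_inter_real_le_sq p hp0 hp1 (φ S) (φ S') h𝒢 hl
        (t := d * (S ∩ S').card) (min_le_left _ _)
      linarith
    · have := pullbackEvent_inter_real_le_of_large p hp0 hp1 (φ S) (φ S') h𝒢 hk hl
      linarith
  have hb0 : ∀ l, 0 ≤ b l := by
    intro l
    simp only [hb]
    split_ifs <;> positivity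
  have hinner : ∀ S ∈ s, ∑ S' ∈ s,
      (μ.real (pullbackEvent (φ S) 𝒢 ∩ pullbackEvent (φ S') 𝒢) - P * P) ≤
        (k + 1) * (x * N * P ^ 2 + P) := by
    intro S hS
    have hSk := (Finset.mem_powersetCard.1 hS).2
    have hxN : 0 ≤ x * N * P ^ 2 := by positivity
    calc _ ≤ ∑ S' ∈ s, b (S ∩ S').card := Finset.sum_le_sum fun S' hS' => hterm S hS S' hS'
      _ = ∑ l ∈ Finset.range (k + 1), ∑ S' ∈ s.filter fun S' => (S ∩ S').card = l,
            b (S ∩ S').card := by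
          refine (Finset.sum_fiberwise_of_maps_to (fun S' _ => ?_) _).symm
          refine Finset.mem_range_succ_iff.2 (hSk ▸ Finset.card_le_card Finset.inter_subset_left)
      _ ≤ ∑ l ∈ Finset.range (k + 1), (x * N * P ^ 2 + P) := by
          refine Finset.sum_le_sum fun l hl => ?_
          have hlk := Finset.mem_range_succ_iff.1 hl
          rw [Finset.sum_congr rfl (g := fun _ => b l)
            fun S' hS' => by rw [(Finset.mem_filter.1 hS').2], Finset.sum_const, nsmul_eq_mul]
          refine (mul_le_mul_of_nonneg_right
            (Nat.cast_le.2 (card_filter_inter_card_le hSk l)) (hb0 l)).trans ?_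
          simp only [hb]
          split_ifs with h1 h2
          · rw [mul_zero]; positivity
          · have := mul_le_mul_of_nonneg_right (hsmall l (by omega) h2) (sq_nonneg P)
            calc _ = ((k.choose l * (Fintype.card V - k).choose (k - l) : ℕ) : ℝ) /
                  ((p : ℝ) ^ (d * l) * (1 - p : ℝ) ^ l.choose 2) * P ^ 2 := by ring
              _ ≤ _ := this
              _ ≤ _ := by linarith
          · have := mul_le_mul_of_nonneg_left (hlarge l hlk (by omega)) hPpos.le
            calc _ = P * (((k.choose l * (Fintype.card V - k).choose (k - l) : ℕ) : ℝ) *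
                  ((k : ℝ) ^ (2 * (d * (k - l))) * ((1 - p : ℝ) ^ (k.choose 2 - l.choose 2) /
                    (1 - p : ℝ) ^ (d * (k - l))))) := by ring
              _ ≤ _ := this
              _ ≤ _ := by linarith
      _ = _ := by
          rw [Finset.sum_const, Finset.card_range, nsmul_eq_mul]
          push_cast
          ring
  have htot := h2.trans (Finset.sum_le_sum hinner)
  rw [Finset.sum_const, nsmul_eq_mul, hscard] at htot
  -- Dividing N(k+1)(xNP² + P) by the squared mean (NP)² leaves (k+1)(x + 1/(NP)).
  refine le_of_mul_le_mul_left (htot.trans (le_of_eq ?_)) (show 0 < (N * P) ^ 2 by positivity)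
  field_simp

theorem comap_isTree_iff {V : Type*} {k : ℕ} (G : SimpleGraph V) (φ : Fin k ↪ V) {S : Finset V}
    (hφ : Finset.univ.map φ = S) : (G.comap φ).IsTree ↔ (G.induce (S : Set V)).IsTree := by
  have hr : ((S : Set V)) = Set.range φ := by
    rw [← hφ]; simp
  rw [hr]
  refine SimpleGraph.Iso.isTree_iff ⟨Equiv.ofInjective φ φ.injective, ?_⟩
  intro a b
  rfl

/-- A tree of size at least two has a leaf, whose removal leaves an induced tree. -/
theorem mem_inducedTreeSizes_pred {V : Type*} {G : SimpleGraph V} {m : ℕ} (hm : 1 ≤ m)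
    (h : m + 1 ∈ inducedTreeSizes G) : m ∈ inducedTreeSizes G := by
  classical
  obtain ⟨S, hS, hT⟩ := h
  have hcard : Fintype.card (S : Set V) = m + 1 := by simpa using hS
  have : Nontrivial (S : Set V) := Fintype.one_lt_card_iff_nontrivial.1 (by omega)
  obtain ⟨v, hv⟩ := hT.connected.exists_connected_induce_compl_singleton_of_finite_nontrivial
  refine ⟨S.erase v, by rw [Finset.card_erase_of_mem (by simp), hS]; rfl, ?_⟩
  have htree : ((G.induce (S : Set V)).induce {v}ᶜ).IsTree :=
    { connected := hv, isAcyclic := hT.isAcyclic.induce _ }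
  refine (SimpleGraph.Iso.isTree_iff ?_).1 htree
  refine ⟨⟨fun x => ⟨x.1.1, ?_⟩, fun x => ⟨⟨x.1, ?_⟩, ?_⟩, fun x => ?_, fun x => ?_⟩, ?_⟩
  · have h1 : x.1 ≠ v := x.2
    have h2 : x.1.1 ∈ S := x.1.2
    simpa [h2] using fun h => h1 (Subtype.ext h)
  · have := x.2
    simp only [Finset.coe_erase, Set.mem_sdiff] at this
    exact this.1
  · have := x.2
    simp only [Finset.coe_erase, Set.mem_sdiff, Set.mem_singleton_iff] at this
    simpa [Subtype.ext_iff] using this.2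
  · rfl
  · rfl
  · intro a b
    rfl

theorem mem_inducedTreeSizes_of_le {V : Type*} {G : SimpleGraph V} {k m : ℕ} (hk : 1 ≤ k)
    (hkm : k ≤ m) (h : m ∈ inducedTreeSizes G) : k ∈ inducedTreeSizes G := by
  induction m, hkm using Nat.le_induction with
  | base => exact h
  | succ m hkm ih => exact ih (mem_inducedTreeSizes_pred (hk.trans hkm) h)

/-- Sets of the wrong size receive an arbitrary embedding, which exists because k ≤ |V|. -/
theorem exists_enumeration {V : Type*} [Fintype V] {k : ℕ} (hk : k ≤ Fintype.card V) :
    ∃ φ : Finset V → (Fin k ↪ V), ∀ S : Finset V, S.card = k → Finset.univ.map (φ S) = S := by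
  have : ∀ S : Finset V, ∃ φ : Fin k ↪ V, S.card = k → Finset.univ.map φ = S := by
    intro S
    by_cases hS : S.card = k
    · subst hS
      refine ⟨S.equivFin.symm.toEmbedding.trans (Function.Embedding.subtype _), fun _ => ?_⟩
      ext x
      simp only [Finset.mem_map, Finset.mem_univ, true_and, Function.Embedding.trans_apply,
        Equiv.coe_toEmbedding, Function.Embedding.subtype_apply]
      constructor
      · rintro ⟨i, rfl⟩
        exact (S.equivFin.symm i).2
      · intro hx
        exact ⟨S.equivFin ⟨x, hx⟩, by simp⟩
    · exact ⟨(Fin.castLEEmb hk).trans (Fintype.equivFin V).symm.toEmbedding, fun h => absurd h hS⟩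
  exact ⟨fun S => (this S).choose, fun S => (this S).choose_spec⟩

/-- The first moment bound for induced trees. -/
theorem inducedTree_real_le {V : Type*} [Fintype V] [DecidableEq V] (p : unitInterval)
    {k : ℕ} (hkV : k ≤ Fintype.card V) :
    (SimpleGraph.binomialRandom V p).real {G | k ∈ inducedTreeSizes G} ≤
      (Fintype.card V).choose k *
        ((k : ℝ) ^ k * ((p : ℝ) ^ (k - 1) * (1 - p : ℝ) ^ (k.choose 2 - (k - 1)))) := by
  obtain ⟨φ, hφ⟩ := exists_enumeration hkV
  have hp0 : (0 : ℝ) ≤ p := p.2.1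
  have hq0 : (0 : ℝ) ≤ 1 - p := by linarith [p.2.2]
  have hset : {G : SimpleGraph V | k ∈ inducedTreeSizes G} =
      ⋃ S ∈ Finset.univ.powersetCard k, pullbackEvent (φ S) (allTrees (Fin k)) := by
    ext G
    simp only [inducedTreeSizes, Set.mem_ofPred_eq, Set.mem_iUnion, pullbackEvent, mem_allTrees,
      Finset.mem_powersetCard, Finset.subset_univ, true_and, exists_prop]
    refine exists_congr fun S => and_congr_right fun hS => ?_
    rw [comap_isTree_iff G _ (hφ S hS)]
  rw [hset]
  refine (MeasureTheory.measureReal_biUnion_finset_le _ _).trans ?_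
  rw [Finset.sum_congr rfl fun S _ => pullbackEvent_real p (φ S) fun T hT => mem_allTrees.1 hT,
    Finset.sum_const, Finset.card_powersetCard, Finset.card_univ, nsmul_eq_mul]
  refine mul_le_mul_of_nonneg_left (mul_le_mul_of_nonneg_right ?_ (by positivity))
    (Nat.cast_nonneg _)
  have := card_allTrees_le (Fin k)
  rw [Fintype.card_fin] at this
  exact_mod_cast this

/-- The two moment bounds together locate the size of a largest induced tree. -/
theorem one_sub_le_real_maxInducedTree {n : ℕ} (p : unitInterval)
    (hp0 : 0 < p) (hp1 : p < 1) {k D : ℕ} (hk : 1 ≤ k) (hkn : k + 2 ≤ n)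
    (hne : (boundedTrees (Fin k) D).Nonempty) {x : ℝ} (hx : 0 ≤ x)
    (hsmall : ∀ l, 2 ≤ l → 2 * l ≤ k →
      ((k.choose l * (n - k).choose (k - l) : ℕ) : ℝ) /
        ((p : ℝ) ^ (D * l) * (1 - p : ℝ) ^ l.choose 2) ≤ x * n.choose k)
    (hlarge : ∀ l, l ≤ k → k < 2 * l →
      ((k.choose l * (n - k).choose (k - l) : ℕ) : ℝ) *
        ((k : ℝ) ^ (2 * (D * (k - l))) *
          ((1 - p : ℝ) ^ (k.choose 2 - l.choose 2) / (1 - p : ℝ) ^ (D * (k - l)))) ≤ 1) :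
    1 - (k + 1) * (x + 1 / (n.choose k * ((boundedTrees (Fin k) D).card *
        ((p : ℝ) ^ (k - 1) * (1 - p : ℝ) ^ (k.choose 2 - (k - 1)))))) -
      n.choose (k + 2) * (((k + 2 : ℕ) : ℝ) ^ (k + 2) *
        ((p : ℝ) ^ (k + 1) * (1 - p : ℝ) ^ ((k + 2).choose 2 - (k + 1)))) ≤
    (SimpleGraph.binomialRandom (Fin n) p).real
      {G | maxInducedTree G = k ∨ maxInducedTree G = k + 1} := by
  set μ := SimpleGraph.binomialRandom (Fin n) p
  have : Nonempty (Fin n) := ⟨⟨0, by omega⟩⟩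
  obtain ⟨φ, hφ⟩ := exists_enumeration (V := Fin n) (k := k) (by rw [Fintype.card_fin]; omega)
  have hlow := no_pullback_real_le (V := Fin n) p hp0 hp1 (d := D) hk
    (by rw [Fintype.card_fin]; omega) (fun T hT => mem_boundedTrees.1 hT) hne φ hφ hx
    (by simpa only [Fintype.card_fin] using hsmall) (by simpa only [Fintype.card_fin] using hlarge)
  have hup := inducedTree_real_le (V := Fin n) p (k := k + 2) (by rw [Fintype.card_fin]; omega)
  rw [Fintype.card_fin] at hlow hup
  set E := {G : SimpleGraph (Fin n) | maxInducedTree G = k ∨ maxInducedTree G = k + 1} with hE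
  set B1 := {G : SimpleGraph (Fin n) | ∀ S ∈ Finset.univ.powersetCard k,
    G ∉ pullbackEvent (φ S) (boundedTrees (Fin k) D)} with hB1
  set B2 := {G : SimpleGraph (Fin n) | k + 2 ∈ inducedTreeSizes G} with hB2
  have hcover : Eᶜ ⊆ B1 ∪ B2 := by
    intro G hG
    by_contra hGB
    simp only [Set.mem_union, not_or] at hGB
    obtain ⟨h1, h2⟩ := hGB
    refine hG ?_
    obtain ⟨hmem, hmax⟩ := isGreatest_maxInducedTree G
    have hge : k ≤ maxInducedTree G := by
      simp only [hB1, Set.mem_ofPred_eq, not_forall, not_not] at h1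
      obtain ⟨S, hS, hGS⟩ := h1
      have hSk := (Finset.mem_powersetCard.1 hS).2
      exact hmax ⟨S, hSk, (comap_isTree_iff G _ (hφ S hSk)).1 (mem_boundedTrees.1 hGS).1⟩
    have hle : maxInducedTree G < k + 2 := by
      by_contra hcon
      exact h2 (mem_inducedTreeSizes_of_le (by omega) (not_lt.1 hcon) hmem)
    simp only [hE, Set.mem_ofPred_eq]
    omega
  have hEc : μ.real Eᶜ = 1 - μ.real E := MeasureTheory.probReal_compl_eq_one_sub .of_discrete
  have h3 := (MeasureTheory.measureReal_mono hcover (μ := μ)).trans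
    (MeasureTheory.measureReal_union_le B1 B2)
  rw [hEc] at h3
  have hup' : μ.real B2 ≤ n.choose (k + 2) * (((k + 2 : ℕ) : ℝ) ^ (k + 2) *
        ((p : ℝ) ^ (k + 1) * (1 - p : ℝ) ^ ((k + 2).choose 2 - (k + 1)))) := hup
  linarith

/-! ### Elementary estimates for factorials and binomials -/

theorem two_mul_choose_two_add (m : ℕ) : 2 * m.choose 2 + m = m * m := by
  induction m with
  | zero => rfl
  | succ m ih =>
    rw [Nat.choose_succ_succ' m 1, Nat.choose_one_right]
    linarith

theorem choose_two_succ_sub (m : ℕ) : (m + 1).choose 2 - m = m.choose 2 := by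
  rw [Nat.choose_succ_succ' m 1, Nat.choose_one_right]
  exact Nat.add_sub_cancel_left _ _

/-- An elementary Stirling-type upper bound. -/
theorem factorial_succ_mul_exp_le (m : ℕ) :
    ((m + 1).factorial : ℝ) * Real.exp 1 ^ m ≤ ((m + 1 : ℕ) : ℝ) ^ (m + 2) := by
  induction m with
  | zero => simp
  | succ m ih =>
    have ha : (0 : ℝ) < ((m + 1 : ℕ) : ℝ) := by positivity
    have hb : (0 : ℝ) < ((m + 2 : ℕ) : ℝ) := by positivity
    -- This is (1 + 1/(m+1))^{m+2} ≥ e, obtained from log x ≥ 1 - 1/x.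
    have hexp : Real.exp 1 * ((m + 1 : ℕ) : ℝ) ^ (m + 2) ≤ ((m + 2 : ℕ) : ℝ) ^ (m + 2) := by
      have hlog := Real.one_sub_inv_le_log_of_pos (x := ((m + 2 : ℕ) : ℝ) / ((m + 1 : ℕ) : ℝ))
        (by positivity)
      have h1 : (1 : ℝ) ≤ ((m + 2 : ℕ) : ℝ) *
          Real.log (((m + 2 : ℕ) : ℝ) / ((m + 1 : ℕ) : ℝ)) := by
        have h2 := mul_le_mul_of_nonneg_left hlog hb.le
        have h3 : ((m + 2 : ℕ) : ℝ) * (1 - (((m + 2 : ℕ) : ℝ) / ((m + 1 : ℕ) : ℝ))⁻¹) = 1 := by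
          field_simp
          push_cast
          ring
        linarith
      have h4 := Real.exp_le_exp.2 h1
      rw [Real.exp_nat_mul, Real.exp_log (by positivity), div_pow,
        le_div_iff₀ (by positivity)] at h4
      exact h4
    have hfac : ((m + 2).factorial : ℝ) = ((m + 2 : ℕ) : ℝ) * (m + 1).factorial := by
      exact_mod_cast Nat.factorial_succ (m + 1)
    show ((m + 2).factorial : ℝ) * Real.exp 1 ^ (m + 1) ≤ ((m + 2 : ℕ) : ℝ) ^ (m + 3)
    calc ((m + 2).factorial : ℝ) * Real.exp 1 ^ (m + 1)
        = ((m + 2 : ℕ) : ℝ) * Real.exp 1 * ((m + 1).factorial * Real.exp 1 ^ m) := by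
          rw [hfac]; ring
      _ ≤ ((m + 2 : ℕ) : ℝ) * Real.exp 1 * ((m + 1 : ℕ) : ℝ) ^ (m + 2) := by
          gcongr
      _ = ((m + 2 : ℕ) : ℝ) * (Real.exp 1 * ((m + 1 : ℕ) : ℝ) ^ (m + 2)) := by ring
      _ ≤ ((m + 2 : ℕ) : ℝ) * ((m + 2 : ℕ) : ℝ) ^ (m + 2) := by gcongr
      _ = _ := by ring

theorem choose_mul_pow_le_exp (n k : ℕ) :
    (n.choose k : ℝ) * (k : ℝ) ^ k ≤ (Real.exp 1 * n) ^ k := by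
  have h1 : (n.choose k : ℝ) ≤ (n : ℝ) ^ k / k.factorial := Nat.choose_le_pow_div k n
  have h2 := Real.pow_div_factorial_le_exp (k : ℝ) (Nat.cast_nonneg k) k
  have h3 : Real.exp k = Real.exp 1 ^ k := by rw [← Real.exp_nat_mul, mul_one]
  rw [h3] at h2
  calc (n.choose k : ℝ) * (k : ℝ) ^ k ≤ (n : ℝ) ^ k / k.factorial * (k : ℝ) ^ k := by gcongr
    _ = (n : ℝ) ^ k * ((k : ℝ) ^ k / k.factorial) := by ring
    _ ≤ (n : ℝ) ^ k * Real.exp 1 ^ k := by gcongr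
    _ = _ := by ring

theorem pow_le_two_mul_factorial_mul_choose {n k : ℕ} (h : 2 * k ^ 2 ≤ n) :
    (n : ℝ) ^ k ≤ 2 * (k.factorial * n.choose k) := by
  rcases Nat.eq_zero_or_pos k with rfl | hk
  · simp
  have hkn : k ≤ n := by nlinarith
  have hn : (0 : ℝ) < n := by exact_mod_cast hk.trans_le hkn
  have h1 : ((n - k : ℕ) : ℝ) ^ k ≤ (k.factorial * n.choose k : ℝ) := by
    rw [← Nat.cast_mul, ← Nat.descFactorial_eq_factorial_mul_choose]
    refine le_trans ?_ (Nat.cast_le.2 (Nat.pow_sub_le_descFactorial n k))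
    push_cast
    gcongr
    omega
  -- Bernoulli's inequality: (1 - k/n)^k ≥ 1 - k²/n ≥ 1/2.
  have h2 : (1 : ℝ) / 2 ≤ (1 + (-(k / n : ℝ))) ^ k := by
    have hkn' : (k / n : ℝ) ≤ 1 := by
      rw [div_le_one hn]
      exact_mod_cast hkn
    refine le_trans ?_ (one_add_mul_le_pow (by linarith) k)
    have : (k : ℝ) * (k / n) ≤ 1 / 2 := by
      rw [← mul_div_assoc, div_le_iff₀ hn]
      have : (2 * k ^ 2 : ℝ) ≤ n := by exact_mod_cast h
      nlinarith
    linarith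
  have h3 : ((n - k : ℕ) : ℝ) = n * (1 + (-(k / n : ℝ))) := by
    rw [Nat.cast_sub hkn]
    field_simp
    ring
  rw [h3, mul_pow] at h1
  have h4 := mul_le_mul_of_nonneg_left h2 (pow_nonneg hn.le k)
  linarith

theorem choose_div_choose_le {n k l : ℕ} (hlk : l ≤ k) (hkn : 2 * k ≤ n) :
    (k.choose l : ℝ) * (n : ℝ) ^ l ≤ n.choose l * (2 * k : ℝ) ^ l := by
  have hf : (0 : ℝ) < l.factorial := by exact_mod_cast l.factorial_pos
  have h1 : (l.factorial * k.choose l : ℝ) ≤ (k : ℝ) ^ l := by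
    rw [← Nat.cast_mul, ← Nat.descFactorial_eq_factorial_mul_choose]
    exact_mod_cast Nat.descFactorial_le_pow k l
  have h2 : (n : ℝ) ^ l ≤ 2 ^ l * (l.factorial * n.choose l : ℝ) := by
    rw [← Nat.cast_mul, ← Nat.descFactorial_eq_factorial_mul_choose]
    calc (n : ℝ) ^ l ≤ (2 * (n + 1 - l : ℕ) : ℝ) ^ l := by
          gcongr
          exact_mod_cast (by omega : n ≤ 2 * (n + 1 - l))
      _ = 2 ^ l * ((n + 1 - l : ℕ) : ℝ) ^ l := by rw [mul_pow]
      _ ≤ _ := by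
          gcongr
          exact_mod_cast Nat.pow_sub_le_descFactorial n l
  refine le_of_mul_le_mul_left ?_ hf
  calc (l.factorial : ℝ) * (k.choose l * (n : ℝ) ^ l)
      = (l.factorial * k.choose l : ℝ) * (n : ℝ) ^ l := by ring
    _ ≤ (k : ℝ) ^ l * (2 ^ l * (l.factorial * n.choose l : ℝ)) := by gcongr
    _ = _ := by rw [mul_pow]; ring

/-- From C(n,k) C(k,l) = C(n,l) C(n-l,k-l), the proportion of k-sets with overlap l is at most
C(k,l)²/C(n,l) ≤ (2k²/n)^l. -/
theorem choose_mul_choose_mul_pow_le {n k l : ℕ} (hlk : l ≤ k) (hkn : 2 * k ≤ n) :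
    ((k.choose l * (n - k).choose (k - l) : ℕ) : ℝ) * (n : ℝ) ^ l ≤
      n.choose k * (2 * k ^ 2 : ℝ) ^ l := by
  have h1 : (n - k).choose (k - l) ≤ (n - l).choose (k - l) := Nat.choose_le_choose _ (by omega)
  have h2 : n.choose k * k.choose l = n.choose l * (n - l).choose (k - l) :=
    Nat.choose_mul hlk
  have h3 := choose_div_choose_le hlk hkn
  have hpos : (0 : ℝ) < n.choose l := by exact_mod_cast Nat.choose_pos (by omega)
  have hle : (k.choose l : ℝ) ≤ (k : ℝ) ^ l := by exact_mod_cast Nat.choose_le_pow k l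
  refine le_of_mul_le_mul_left ?_ hpos
  calc (n.choose l : ℝ) * (((k.choose l * (n - k).choose (k - l) : ℕ) : ℝ) * (n : ℝ) ^ l)
      ≤ (n.choose l : ℝ) * (((k.choose l * (n - l).choose (k - l) : ℕ) : ℝ) * (n : ℝ) ^ l) := by
        gcongr
    _ = ((n.choose l * (n - l).choose (k - l) : ℕ) : ℝ) * (k.choose l * (n : ℝ) ^ l) := by
        push_cast; ring
    _ = ((n.choose k * k.choose l : ℕ) : ℝ) * (k.choose l * (n : ℝ) ^ l) := by rw [h2]
    _ ≤ ((n.choose k * k.choose l : ℕ) : ℝ) * (n.choose l * (2 * k : ℝ) ^ l) := by gcongr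
    _ = n.choose k * (n.choose l * (2 * k : ℝ) ^ l) * (k.choose l) := by push_cast; ring
    _ ≤ n.choose k * (n.choose l * (2 * k : ℝ) ^ l) * (k : ℝ) ^ l := by gcongr
    _ = _ := by rw [show (2 * k ^ 2 : ℝ) = 2 * k * k by ring, mul_pow (2 * k : ℝ)]; ring

/-! ### Numerical estimates at the threshold, with 1 - p = t^8 -/

section Estimates

variable {p t : ℝ} {n k D : ℕ}

/-- The expected number of induced trees on `k + 2` vertices is small. -/
theorem firstMoment_le (hp : 0 < p) (ht0 : 0 < t) (ht1 : t < 1)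
    (hup : Real.exp 1 * n * p * t ^ (4 * k) ≤ t ^ 6) :
    n.choose (k + 2) * (((k + 2 : ℕ) : ℝ) ^ (k + 2) *
      (p ^ (k + 1) * (t ^ 8) ^ ((k + 2).choose 2 - (k + 1)))) ≤ t ^ k / p := by
  have hc : (k + 2).choose 2 - (k + 1) = (k + 1).choose 2 := choose_two_succ_sub (k + 1)
  have h2 := two_mul_choose_two_add (k + 1)
  have hz := pow_le_pow_left₀ (by positivity) hup (k + 2)
  rw [hc, le_div_iff₀ hp]
  refine le_of_mul_le_mul_right ?_ (show 0 < t ^ (4 * k) by positivity)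
  -- The extra factor t^{4k} completes the exponent, so that one factor t^{4k} is available for each
  -- of the k + 2 copies of enp.
  have hexp : 8 * (k + 1).choose 2 + 4 * k = 4 * k * (k + 2) := by nlinarith
  calc n.choose (k + 2) * (((k + 2 : ℕ) : ℝ) ^ (k + 2) *
        (p ^ (k + 1) * (t ^ 8) ^ ((k + 1).choose 2))) * p * t ^ (4 * k)
      = (n.choose (k + 2) * ((k + 2 : ℕ) : ℝ) ^ (k + 2)) *
          (p ^ (k + 2) * t ^ (8 * (k + 1).choose 2 + 4 * k)) := by
        rw [pow_add t, pow_mul]; ring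
    _ ≤ (Real.exp 1 * n) ^ (k + 2) * (p ^ (k + 2) * t ^ (8 * (k + 1).choose 2 + 4 * k)) := by
        gcongr
        exact choose_mul_pow_le_exp n (k + 2)
    _ = (Real.exp 1 * n * p * t ^ (4 * k)) ^ (k + 2) := by
        rw [hexp, mul_pow _ (t ^ (4 * k)), ← pow_mul, mul_pow _ p]
        ring
    _ ≤ (t ^ 6) ^ (k + 2) := hz
    _ = t ^ (6 * k + 12) := by rw [← pow_mul]; ring_nf
    _ ≤ t ^ (k + 4 * k) := pow_le_pow_of_le_one ht0.le ht1.le (by omega)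
    _ = _ := by rw [pow_add]

/-- The expected number of induced trees of bounded degree on `k` vertices is large. -/
theorem inv_expected_boundedTrees_le (hp : 0 < p) (ht0 : 0 < t) (hD : 0 < D)
    (hDt : t ≤ 1 - 1 / (D : ℝ)) (hk : 1 ≤ k) (hkn : 2 * k ^ 2 ≤ n)
    (hlow : t ^ 10 ≤ Real.exp 1 * n * p * t ^ (4 * k)) :
    1 / (n.choose k * ((boundedTrees (Fin k) (D + 1)).card *
        (p ^ (k - 1) * (t ^ 8) ^ (k.choose 2 - (k - 1))))) ≤
      2 * Real.exp 1 * p / t ^ 7 * (k ^ 3 * t ^ k) := by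
  obtain ⟨m, rfl⟩ : ∃ m, k = m + 1 := ⟨k - 1, by omega⟩
  have : Nonempty (Fin (m + 1)) := ⟨0⟩
  have hτ := card_boundedTrees_ge (Fin (m + 1)) hD
  rw [Fintype.card_fin, Nat.add_sub_cancel] at hτ
  rw [Nat.add_sub_cancel, choose_two_succ_sub]
  set τ : ℝ := ((boundedTrees (Fin (m + 1)) (D + 1)).card : ℝ)
  set K : ℝ := ((m + 1 : ℕ) : ℝ) with hK
  have hKpos : 0 < K := by positivity
  set e := Real.exp 1
  have he : 0 < e := Real.exp_pos 1
  have h1 := pow_le_two_mul_factorial_mul_choose hkn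
  have h2 := factorial_succ_mul_exp_le m
  set F : ℝ := ((m + 1).factorial : ℝ)
  set C : ℝ := (n.choose (m + 1) : ℝ)
  have hF : 0 < F := Nat.cast_pos.2 (m + 1).factorial_pos
  have hC0 : 0 ≤ C := Nat.cast_nonneg _
  have hτ0 : 0 ≤ τ := Nat.cast_nonneg _
  -- The degree bound costs at most a factor t for each non-root vertex.
  have hτ' : (t * K) ^ m ≤ K * τ := le_trans (by gcongr) hτ
  set X := C * (τ * (p ^ m * (t ^ 8) ^ (m.choose 2))) with hX
  have hX0 : 0 ≤ X := by positivity
  have hmain : (e * n * p) ^ (m + 1) * t ^ m * (t ^ 8) ^ m.choose 2 ≤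
      X * (2 * e * p * K ^ 3) := by
    refine le_of_mul_le_mul_right ?_ (show 0 < K ^ (m + 2) by positivity)
    calc (e * n * p) ^ (m + 1) * t ^ m * (t ^ 8) ^ m.choose 2 * K ^ (m + 2)
        = (n : ℝ) ^ (m + 1) * ((t * K) ^ m) *
            (e ^ (m + 1) * p ^ (m + 1) * (t ^ 8) ^ m.choose 2 * K ^ 2) := by
          rw [mul_pow, mul_pow, mul_pow]; ring
      _ ≤ (2 * (F * C)) * (K * τ) *
            (e ^ (m + 1) * p ^ (m + 1) * (t ^ 8) ^ m.choose 2 * K ^ 2) := by gcongr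
      _ = X * (2 * e * p * K ^ 3) * (F * e ^ m) := by rw [hX]; ring
      _ ≤ X * (2 * e * p * K ^ 3) * K ^ (m + 2) := by gcongr
  have hz := pow_le_pow_left₀ (by positivity) hlow (m + 1)
  have hexp := two_mul_choose_two_add m
  -- Since 4(m+1)² = 8 C(m,2) + 12m + 4, cancelling t^{11m+4} leaves a spare t^m on the right: the
  -- mean is exponentially large.
  have hmain2 : t ^ 6 ≤ X * (2 * e * p * K ^ 3) * t ^ m := by
    refine le_of_mul_le_mul_right ?_ (show 0 < t ^ (11 * m + 4) by positivity)
    calc t ^ 6 * t ^ (11 * m + 4) = (t ^ 10) ^ (m + 1) * t ^ m := by ring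
      _ ≤ (e * n * p * t ^ (4 * (m + 1))) ^ (m + 1) * t ^ m := by gcongr
      _ = (e * n * p) ^ (m + 1) * t ^ m * t ^ (4 * (m + 1) * (m + 1)) := by
          rw [mul_pow _ (t ^ (4 * (m + 1))), ← pow_mul]; ring
      _ = (e * n * p) ^ (m + 1) * t ^ m * t ^ (8 * m.choose 2 + m + (11 * m + 4)) := by
          congr 2
          nlinarith
      _ = ((e * n * p) ^ (m + 1) * t ^ m * (t ^ 8) ^ m.choose 2) * t ^ m * t ^ (11 * m + 4) := by
          rw [← pow_mul]; ring
      _ ≤ _ := by gcongr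
  have hXpos : 0 < X := by
    refine lt_of_le_of_ne hX0 fun h => ?_
    rw [← h] at hmain2
    have : 0 < t ^ 6 := by positivity
    linarith
  rw [div_le_iff₀ hXpos]
  have : 2 * e * p / t ^ 7 * (K ^ 3 * t ^ (m + 1)) * X =
      X * (2 * e * p * K ^ 3) * t ^ m / t ^ 6 := by
    field_simp
    ring
  rw [this, le_div_iff₀ (by positivity), one_mul]
  exact hmain2

theorem boundedTrees_nonempty (hD : 0 < D) (ht0 : 0 < t) (hDt : t ≤ 1 - 1 / (D : ℝ))
    (hk : 1 ≤ k) : (boundedTrees (Fin k) (D + 1)).Nonempty := by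
  have : Nonempty (Fin k) := ⟨⟨0, hk⟩⟩
  have hτ := card_boundedTrees_ge (Fin k) hD
  rw [Fintype.card_fin] at hτ
  have hkpos : (0 : ℝ) < k := by exact_mod_cast hk
  have h1 : (0 : ℝ) < 1 - 1 / (D : ℝ) := ht0.trans_le hDt
  have h2 : (0 : ℝ) < ((1 - 1 / (D : ℝ)) * k) ^ (k - 1) := by positivity
  by_contra h
  rw [Finset.not_nonempty_iff_eq_empty] at h
  rw [h, Finset.card_empty, Nat.cast_zero, mul_zero] at hτ
  linarith

/-- Pairs of `k`-sets with small overlap contribute little to the variance. -/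
theorem smallOverlap_le (hp : 0 < p) (ht0 : 0 < t) (ht1 : t < 1) {d l : ℕ} (hl : 2 ≤ l)
    (hlk : 2 * l ≤ k) (hkn : 2 * k ≤ n) (hlow : t ^ 10 ≤ Real.exp 1 * n * p * t ^ (4 * k))
    (hx : 2 * Real.exp 1 * p / (p ^ d * t ^ 10) * (k ^ 2 * (t ^ 2) ^ k) ≤ 1) :
    ((k.choose l * (n - k).choose (k - l) : ℕ) : ℝ) / (p ^ (d * l) * (t ^ 8) ^ l.choose 2) ≤
      2 * Real.exp 1 * p / (p ^ d * t ^ 10) * (k ^ 2 * (t ^ 2) ^ k) * n.choose k := by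
  set x := 2 * Real.exp 1 * p / (p ^ d * t ^ 10) * (k ^ 2 * (t ^ 2) ^ k) with hxdef
  have hn : (0 : ℝ) < n := by exact_mod_cast (by omega : 0 < n)
  have hx0 : 0 ≤ x := by positivity
  have hbase : (2 * k ^ 2 : ℝ) ≤ x * (n * (p ^ d * t ^ (4 * (l - 1)))) := by
    -- As l ≤ k/2, the overlap gain per vertex uses at most half of the t^{4k} supplied by n.
    have h1 : t ^ (2 * k) ≤ t ^ (4 * (l - 1)) := pow_le_pow_of_le_one ht0.le ht1.le (by omega)
    calc (2 * k ^ 2 : ℝ) = 2 * k ^ 2 / t ^ 10 * t ^ 10 := by field_simp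
      _ ≤ 2 * k ^ 2 / t ^ 10 * (Real.exp 1 * n * p * t ^ (4 * k)) := by gcongr
      _ = x * (n * (p ^ d * t ^ (2 * k))) := by
          rw [hxdef, ← pow_mul, show 4 * k = 2 * k + 2 * k by ring, pow_add t (2 * k)]
          field_simp
      _ ≤ _ := by gcongr
  have hexp : (t ^ 8) ^ l.choose 2 = (t ^ (4 * (l - 1))) ^ l := by
    rw [← pow_mul, ← pow_mul]
    congr 1
    obtain ⟨m, rfl⟩ : ∃ m, l = m + 1 := ⟨l - 1, by omega⟩
    have := two_mul_choose_two_add (m + 1)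
    rw [Nat.add_sub_cancel]
    nlinarith
  have hC := choose_mul_choose_mul_pow_le (n := n) (by omega : l ≤ k) hkn
  rw [div_le_iff₀ (by positivity)]
  refine le_of_mul_le_mul_right ?_ (show (0 : ℝ) < (n : ℝ) ^ l by positivity)
  refine hC.trans ?_
  calc (n.choose k : ℝ) * (2 * k ^ 2 : ℝ) ^ l
      ≤ n.choose k * (x * (n * (p ^ d * t ^ (4 * (l - 1))))) ^ l := by gcongr
    _ = x ^ l * (n.choose k * ((p ^ (d * l) * (t ^ (4 * (l - 1))) ^ l) * (n : ℝ) ^ l)) := by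
        rw [mul_pow, mul_pow, mul_pow, pow_mul]; ring
    _ ≤ x * (n.choose k * ((p ^ (d * l) * (t ^ (4 * (l - 1))) ^ l) * (n : ℝ) ^ l)) := by
        gcongr
        exact pow_le_of_le_one hx0 hx (by omega)
    _ = _ := by rw [hexp]; ring

/-- Pairs of `k`-sets with large overlap contribute little to the variance. -/
theorem largeOverlap_le (hp : 0 < p) (ht0 : 0 < t) (ht1 : t < 1) {d l : ℕ}
    (hlk : l ≤ k) (hkl : k < 2 * l) (hup : Real.exp 1 * n * p * t ^ (4 * k) ≤ t ^ 6)
    (hy : 1 / (Real.exp 1 * p * (t ^ 8) ^ d) * (k ^ (2 * d + 1) * (t ^ 2) ^ k) ≤ 1) :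
    ((k.choose l * (n - k).choose (k - l) : ℕ) : ℝ) *
        ((k : ℝ) ^ (2 * (d * (k - l))) *
          ((t ^ 8) ^ (k.choose 2 - l.choose 2) / (t ^ 8) ^ (d * (k - l)))) ≤ 1 := by
  obtain ⟨j, rfl⟩ : ∃ j, k = l + j := ⟨k - l, by omega⟩
  rw [Nat.add_sub_cancel_left]
  set k := l + j with hk
  set y := 1 / (Real.exp 1 * p * (t ^ 8) ^ d) * (k ^ (2 * d + 1) * (t ^ 2) ^ k) with hydef
  have hk1 : 1 ≤ k := by omega
  have hch : (k.choose l * (n - k).choose j : ℕ) ≤ k ^ j * n ^ j := by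
    have h1 : k.choose l = k.choose j := by
      rw [hk, Nat.choose_symm_add]
    rw [h1]
    refine Nat.mul_le_mul (Nat.choose_le_pow _ _) ((Nat.choose_le_pow _ _).trans ?_)
    exact Nat.pow_le_pow_left (Nat.sub_le _ _) _
  -- C(k,2) - C(l,2) = j(k + l - 1)/2, so each of the j new vertices contributes the same power of
  -- t.
  have hexp : (t ^ 8) ^ (k.choose 2 - l.choose 2) = (t ^ (4 * (k + l - 1))) ^ j := by
    rw [← pow_mul, ← pow_mul]
    congr 1
    have h1 := two_mul_choose_two_add k
    have h2 := two_mul_choose_two_add l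
    have h3 : l.choose 2 ≤ k.choose 2 := Nat.choose_le_choose _ hlk
    obtain ⟨c, hc⟩ : ∃ c, k + l = c + 1 := ⟨k + l - 1, by omega⟩
    rw [hc, Nat.add_sub_cancel]
    zify [h3] at *
    have hc' : (c : ℤ) = k + l - 1 := by linarith
    have hj : (j : ℤ) = k - l := by linarith
    rw [hc', hj]
    linarith
  have hbase : (k : ℝ) * n * k ^ (2 * d) * t ^ (4 * (k + l - 1)) / (t ^ 8) ^ d ≤ y := by
    -- From 2l ≥ k + 1 the exponent is at least 6k - 2; about 4k of it cancels n and the remaining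
    -- t^{2k} beats the powers of k.
    have h1 : t ^ (4 * (k + l - 1)) ≤ t ^ (6 * k - 2) :=
      pow_le_pow_of_le_one ht0.le ht1.le (by omega)
    have h2 : t ^ (6 * k - 2) * t ^ 2 = t ^ (4 * k) * t ^ (2 * k) := by
      rw [← pow_add, ← pow_add]
      congr 1
      omega
    have h3 : t ^ 6 ≤ t ^ 2 := pow_le_pow_of_le_one ht0.le ht1.le (by omega)
    have he := Real.exp_pos 1
    have h4 : (n : ℝ) * t ^ (6 * k - 2) ≤ (t ^ 2) ^ k / (Real.exp 1 * p) := by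
      rw [le_div_iff₀ (by positivity)]
      refine le_of_mul_le_mul_right ?_ (show 0 < t ^ 2 by positivity)
      calc (n : ℝ) * t ^ (6 * k - 2) * (Real.exp 1 * p) * t ^ 2
          = (Real.exp 1 * n * p) * (t ^ (6 * k - 2) * t ^ 2) := by ring
        _ = (Real.exp 1 * n * p * t ^ (4 * k)) * t ^ (2 * k) := by rw [h2]; ring
        _ ≤ t ^ 2 * t ^ (2 * k) := by
            gcongr
            exact hup.trans h3
        _ = _ := by rw [pow_mul]; ring
    calc (k : ℝ) * n * k ^ (2 * d) * t ^ (4 * (k + l - 1)) / (t ^ 8) ^ d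
        ≤ (k : ℝ) * n * k ^ (2 * d) * t ^ (6 * k - 2) / (t ^ 8) ^ d := by gcongr
      _ = (k : ℝ) ^ (2 * d + 1) / (t ^ 8) ^ d * (n * t ^ (6 * k - 2)) := by ring
      _ ≤ (k : ℝ) ^ (2 * d + 1) / (t ^ 8) ^ d * ((t ^ 2) ^ k / (Real.exp 1 * p)) := by gcongr
      _ = y := by rw [hydef]; field_simp
  calc _ ≤ ((k ^ j * n ^ j : ℕ) : ℝ) * ((k : ℝ) ^ (2 * (d * j)) *
          ((t ^ 8) ^ (k.choose 2 - l.choose 2) / (t ^ 8) ^ (d * j))) := by gcongr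
    _ = ((k : ℝ) * n * k ^ (2 * d) * t ^ (4 * (k + l - 1)) / (t ^ 8) ^ d) ^ j := by
        rw [hexp]
        push_cast
        rw [div_pow, mul_pow, mul_pow, mul_pow, ← pow_mul (k : ℝ), ← pow_mul (t ^ 8),
          mul_assoc 2 d j]
        ring
    _ ≤ 1 := pow_le_one₀ (by positivity) (hbase.trans hy)

end Estimates

/-! ### Passage to the limit -/

theorem tendsto_const_mul_pow_mul_pow (c : ℝ) (a : ℕ) {r : ℝ} (hr0 : 0 ≤ r) (hr1 : r < 1) :
    Tendsto (fun k : ℕ => c * ((k : ℝ) ^ a * r ^ k)) atTop (𝓝 0) := by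
  have := (tendsto_pow_const_mul_const_pow_of_abs_lt_one a
    (show |r| < 1 by rwa [abs_of_nonneg hr0])).const_mul c
  simpa using this

/-- The bound on the probability that the largest induced tree is not located by `k`. -/
noncomputable def failureBound (p t : ℝ) (D k : ℕ) : ℝ :=
  (k + 1) * (2 * Real.exp 1 * p / (p ^ (D + 1) * t ^ 10) * (k ^ 2 * (t ^ 2) ^ k) +
    2 * Real.exp 1 * p / t ^ 7 * (k ^ 3 * t ^ k)) + t ^ k / p

theorem tendsto_failureBound (p : ℝ) {t : ℝ} (D : ℕ) (ht0 : 0 < t) (ht1 : t < 1) :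
    Tendsto (failureBound p t D) atTop (𝓝 0) := by
  have ht2 : t ^ 2 < 1 := pow_lt_one₀ ht0.le ht1 two_ne_zero
  have h1 := tendsto_const_mul_pow_mul_pow (2 * Real.exp 1 * p / (p ^ (D + 1) * t ^ 10)) 3
    (sq_nonneg t) ht2
  have h2 := tendsto_const_mul_pow_mul_pow (2 * Real.exp 1 * p / (p ^ (D + 1) * t ^ 10)) 2
    (sq_nonneg t) ht2
  have h3 := tendsto_const_mul_pow_mul_pow (2 * Real.exp 1 * p / t ^ 7) 4 ht0.le ht1
  have h4 := tendsto_const_mul_pow_mul_pow (2 * Real.exp 1 * p / t ^ 7) 3 ht0.le ht1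
  have h5 := tendsto_const_mul_pow_mul_pow (1 / p) 0 ht0.le ht1
  have := (((h1.add h2).add h3).add h4).add h5
  simp only [add_zero] at this
  refine this.congr fun k => ?_
  simp only [failureBound]
  ring

/-- The failure bound depends on k alone. Once k is large it holds for every n in the window, so it
can be evaluated at k = f_ε(n). -/
theorem eventually_one_sub_failureBound_le (p : unitInterval) (hp0 : 0 < p) (hp1 : p < 1) {t : ℝ}
    {D : ℕ} (ht0 : 0 < t) (ht1 : t < 1) (htp : (1 - p : ℝ) = t ^ 8) (hD : 0 < D)
    (hDt : t ≤ 1 - 1 / (D : ℝ)) :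
    ∀ᶠ k : ℕ in atTop, ∀ n : ℕ, t ^ 10 ≤ Real.exp 1 * n * p * t ^ (4 * k) →
      Real.exp 1 * n * p * t ^ (4 * k) ≤ t ^ 6 →
      1 - failureBound p t D k ≤ (SimpleGraph.binomialRandom (Fin n) p).real
        {G | maxInducedTree G = k ∨ maxInducedTree G = k + 1} := by
  have hp : (0 : ℝ) < p := hp0
  have he := Real.exp_pos 1
  have ht2 : t ^ 2 < 1 := pow_lt_one₀ ht0.le ht1 two_ne_zero
  have ht4 : t ^ 4 < 1 := pow_lt_one₀ ht0.le ht1 four_ne_zero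
  filter_upwards [eventually_ge_atTop 2,
    (tendsto_const_mul_pow_mul_pow (2 * Real.exp 1 * p / ((p : ℝ) ^ (D + 1) * t ^ 10)) 2
      (sq_nonneg t) ht2).eventually_le_const zero_lt_one,
    (tendsto_const_mul_pow_mul_pow (1 / (Real.exp 1 * p * (t ^ 8) ^ (D + 1))) (2 * (D + 1) + 1)
      (sq_nonneg t) ht2).eventually_le_const zero_lt_one,
    (tendsto_const_mul_pow_mul_pow (2 * Real.exp 1 * p / t ^ 10) 2
      (by positivity) ht4).eventually_le_const zero_lt_one] with k hk hx hy hz n hlow hup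
  -- The lower window bound makes n at least of order t^{-4k}, exponential in k.
  have hkn : 2 * k ^ 2 ≤ n := by
    have h1 : 2 * (k : ℝ) ^ 2 * (Real.exp 1 * p * (t ^ 4) ^ k) ≤
        n * (Real.exp 1 * p * (t ^ 4) ^ k) := by
      have h2 := mul_le_mul_of_nonneg_right hz (show 0 ≤ t ^ 10 by positivity)
      have h3 : 2 * Real.exp 1 * p / t ^ 10 * (k ^ 2 * (t ^ 4) ^ k) * t ^ 10 =
          2 * (k : ℝ) ^ 2 * (Real.exp 1 * p * (t ^ 4) ^ k) := by field_simp
      rw [h3, one_mul] at h2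
      refine h2.trans (hlow.trans (le_of_eq ?_))
      rw [pow_mul]
      ring
    have := le_of_mul_le_mul_right h1 (by positivity)
    exact_mod_cast this
  have hk2n : 2 * k ≤ n := by nlinarith
  have hbase := one_sub_le_real_maxInducedTree (n := n) p hp0 hp1 (k := k) (D := D + 1)
    (by omega) (by nlinarith) (boundedTrees_nonempty hD ht0 hDt (by omega))
    (x := 2 * Real.exp 1 * p / ((p : ℝ) ^ (D + 1) * t ^ 10) * (k ^ 2 * (t ^ 2) ^ k))
    (by positivity)
    (fun l hl hlk => by
      rw [htp]; exact smallOverlap_le hp ht0 ht1 hl hlk hk2n hlow hx)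
    (fun l hlk hkl => by
      rw [htp]; exact largeOverlap_le hp ht0 ht1 hlk hkl hup hy)
  rw [htp] at hbase
  refine le_trans ?_ hbase
  have hE := inv_expected_boundedTrees_le hp ht0 hD hDt (by omega : 1 ≤ k) hkn hlow
  have hF := firstMoment_le (k := k) hp ht0 ht1 hup
  simp only [failureBound]
  have := mul_le_mul_of_nonneg_left hE (show (0 : ℝ) ≤ k + 1 by positivity)
  linarith

/-- In terms of `k = f_{1/2}(n)` the number `e n p` is pinned down up to a constant factor. -/
theorem treeThreshold_bounds {p t : ℝ} (hp : 0 < p) (ht0 : 0 < t) (ht1 : t < 1)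
    (htp : 1 - p = t ^ 8) {n k : ℕ} (hn : 0 < n) (hk : (k : ℤ) = treeThreshold p (1 / 2) n) :
    t ^ 10 ≤ Real.exp 1 * n * p * t ^ (4 * k) ∧ Real.exp 1 * n * p * t ^ (4 * k) ≤ t ^ 6 := by
  have hnR : (0 : ℝ) < n := by exact_mod_cast hn
  set z := Real.exp 1 * n * p with hz
  have hzpos : 0 < z := by have := Real.exp_pos 1; positivity
  have hlt : Real.log t < 0 := Real.log_neg ht0 ht1
  have hlt0 := hlt.ne
  have hL : Real.logb (1 / (1 - p)) z * (8 * Real.log t) = -Real.log z := by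
    rw [htp, Real.logb, one_div, Real.log_inv, Real.log_pow]
    push_cast
    field_simp
  set L := Real.logb (1 / (1 - p)) z with hLdef
  -- The floor gives k - 5/2 ≤ 2L < k - 3/2. As z = t^{-8L}, the exponent 4k - 8L of z t^{4k} lies
  -- in (6, 10].
  obtain ⟨h1, h2⟩ := Int.floor_eq_iff.1 (show ⌊2 * L + 2 + 1 / 2⌋ = (k : ℤ) from hk.symm)
  push_cast at h1 h2
  have key : Real.log (z * t ^ (4 * k)) = Real.log z + 4 * k * Real.log t := by
    rw [Real.log_mul hzpos.ne' (by positivity), Real.log_pow]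
    push_cast
    ring
  constructor
  · rw [← Real.log_le_log_iff (by positivity) (by positivity), key, Real.log_pow]
    push_cast
    nlinarith
  · rw [← Real.log_le_log_iff (by positivity) (by positivity), key, Real.log_pow]
    push_cast
    nlinarith

theorem tendsto_treeThreshold {p : ℝ} (hp0 : 0 < p) (hp1 : p < 1) (ε : ℝ) :
    Tendsto (treeThreshold p ε) atTop atTop := by
  have hb : 1 < 1 / (1 - p) := by
    rw [lt_div_iff₀ (by linarith)]
    linarith
  have he := Real.exp_pos 1
  have h1 : Tendsto (fun n : ℕ => Real.exp 1 * (n : ℝ) * p) atTop atTop :=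
    (tendsto_natCast_atTop_atTop.const_mul_atTop he).atTop_mul_const hp0
  have h2 := (Real.tendsto_logb_atTop hb).comp h1
  have h3 : Tendsto (fun n : ℕ => 2 * Real.logb (1 / (1 - p)) (Real.exp 1 * n * p) + 2 + ε)
      atTop atTop :=
    tendsto_atTop_add_const_right _ _ (tendsto_atTop_add_const_right _ _
      (h2.const_mul_atTop two_pos))
  exact tendsto_floor_atTop.comp h3

theorem theorem2 (p : unitInterval) (hp0 : 0 < p) (hp1 : p < 1) :
    ∃ ε : ℝ, 0 < ε ∧
      Tendsto
        (fun n : ℕ =>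
          SimpleGraph.binomialRandom (Fin n) p
            {G : SimpleGraph (Fin n) |
              (maxInducedTree G : ℤ) = treeThreshold p ε n ∨
                (maxInducedTree G : ℤ) = treeThreshold p ε n + 1})
        atTop (𝓝 1) := by
  have hp : (0 : ℝ) < p := hp0
  have hp' : (p : ℝ) < 1 := hp1
  have hq0 : (0 : ℝ) < 1 - p := by linarith
  -- The middle of (0,1) shares the slack equally: k - 2L must stay above 1 for the first moment and
  -- below 3 for the second.
  refine ⟨1 / 2, by norm_num, ?_⟩
  -- An eighth root keeps all exponents integral, including the window 6 and 10, and makes t^k small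
  -- enough a loss to spend on the degree bound.
  obtain ⟨t, ht0, ht1, htp⟩ : ∃ t : ℝ, 0 < t ∧ t < 1 ∧ (1 - p : ℝ) = t ^ 8 := by
    refine ⟨(1 - p : ℝ) ^ (1 / 8 : ℝ), by positivity,
      Real.rpow_lt_one hq0.le (by linarith) (by norm_num), ?_⟩
    rw [← Real.rpow_natCast, ← Real.rpow_mul hq0.le]
    norm_num
  obtain ⟨D, hD, hDt⟩ : ∃ D : ℕ, 0 < D ∧ t ≤ 1 - 1 / (D : ℝ) := by
    obtain ⟨m, hm⟩ := exists_nat_one_div_lt (show (0 : ℝ) < 1 - t by linarith)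
    refine ⟨m + 1, Nat.succ_pos m, ?_⟩
    push_cast
    linarith
  have hth := tendsto_treeThreshold hp hp' (1 / 2)
  -- The threshold tends to infinity, so truncating negative values by `toNat` matters for only
  -- finitely many n.
  have hκ : Tendsto (fun n => (treeThreshold p (1 / 2) n).toNat) atTop atTop := by
    refine tendsto_atTop.2 fun m => ?_
    filter_upwards [hth.eventually_ge_atTop (m : ℤ)] with n hn
    omega
  have hfail : Tendsto (fun n => ENNReal.ofReal
      (1 - failureBound p t D (treeThreshold p (1 / 2) n).toNat)) atTop (𝓝 1) := by
    have := ENNReal.tendsto_ofReal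
      (((tendsto_failureBound p D ht0 ht1).comp hκ).const_sub 1)
    simpa using this
  refine tendsto_of_tendsto_of_tendsto_of_le_of_le' hfail tendsto_const_nhds ?_
    (Eventually.of_forall fun n => MeasureTheory.prob_le_one)
  filter_upwards [hκ.eventually (eventually_one_sub_failureBound_le p hp0 hp1 ht0 ht1 htp hD hDt),
    hth.eventually_ge_atTop 0, eventually_gt_atTop 0] with n hmain hnn hn
  have hk : ((treeThreshold p (1 / 2) n).toNat : ℤ) = treeThreshold p (1 / 2) n :=
    Int.toNat_of_nonneg hnn
  obtain ⟨hlow, hup⟩ := treeThreshold_bounds hp ht0 ht1 htp hn hk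
  refine ENNReal.ofReal_le_of_le_toReal ((hmain n hlow hup).trans ?_)
  refine MeasureTheory.measureReal_mono fun G hG => ?_
  simp only [Set.mem_ofPred_eq] at hG ⊢
  omega
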